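/- Let $h:[1,\infty)\to[0,\infty)$ be continuous, eventually positive and slowly varying, i.e. $\lim_{x\to\infty}h(\lambda x)/h(x)=1$ for every $\lambda>0$. Let $\alpha>0$, $0<\rho<1$, and suppose that the real sequence $(c_n)_{n\ge 1}$ is given by $c_n=h(n)\,n^{\alpha-1}\rho^{-n}$ for all $n\ge 1$ (such a sequence is called expansive). Put $$C(x)=\sum_{k\ge 1}c_kx^k,\qquad G(x,y)=\exp\Big\{\sum_{j\ge 1}\frac{C(x^j)}{j}y^j\Big\},\qquad G^{\ge 2}(x,y)=\exp\Big\{\sum_{j\ge 2}\frac{C(x^j)}{j}y^j\Big\},$$ and write $[x^n]G(x,1)$ for the coefficient of $x^n$ in the power series $G(x,1)$. Then for every integer $n\ge 1$ the equation $zC'(z)=n$ has a unique solution $z=z_n$ in the interval $(0,\rho)$, the series $\sum_{j\ge 2}C(\rho^j)/j$ defining $G^{\ge 2}(\rho,1)$ converges, and, as $n\to\infty$, $$z_n\to\rho\qquad\text{and}\qquad [x^n]G(x,1)\sim G^{\ge 2}(\rho,1)\cdot\frac{e^{C(z_n)}}{\sqrt{2\pi z_n^2C''(z_n)}}\cdot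 z_n^{-n}.$$ -/

import Mathlib

open Filter Topology Asymptotics

/-- `h : [1,∞) → [0,∞)` (given as a function on `ℝ` of which only the values on `[1,∞)` matter)
is continuous, eventually positive and slowly varying. -/
structure IsSlowlyVarying (h : ℝ → ℝ) : Prop where
  nonneg : ∀ x : ℝ, 1 ≤ x → 0 ≤ h x
  continuousOn : ContinuousOn h (Set.Ici 1)
  eventually_pos : ∀ᶠ x in atTop, 0 < h x
  tendsto_ratio : ∀ l : ℝ, 0 < l → Tendsto (fun x => h (l * x) / h x) atTop (𝓝 1)

/-- The sequence `(c n)`, `n ≥ 1`, is expansive with parameters `α > 0` and `0 < ρ < 1`: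
`c n = h(n) n^(α-1) ρ^(-n)` for all `n ≥ 1`. The value `c 0` plays no role. -/
structure IsExpansive (c : ℕ → ℝ) (α ρ : ℝ) : Prop where
  alpha_pos : 0 < α
  rho_pos : 0 < ρ
  rho_lt_one : ρ < 1
  exists_slowlyVarying : ∃ h : ℝ → ℝ, IsSlowlyVarying h ∧
    ∀ n : ℕ, 1 ≤ n → c n = h n * (n : ℝ) ^ (α - 1) * ρ ^ (-(n : ℤ))

/-- The formal power series `C(x) = ∑_{k ≥ 1} c k x^k`. -/
noncomputable def genSeries (c : ℕ → ℝ) : PowerSeries ℝ :=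
  PowerSeries.mk fun k => if k = 0 then 0 else c k

/-- The sum `C(x) = ∑_{k ≥ 1} c k x^k` as a function of the real variable `x`. -/
noncomputable def genFun (c : ℕ → ℝ) (x : ℝ) : ℝ :=
  ∑' k : ℕ, PowerSeries.coeff k (genSeries c) * x ^ k

/-- The formal power series `∑_{j ≥ 1} C(x^j) y^j / j` in `x`, for a real number `y`.
As `C` has no constant term, only the `j` with `1 ≤ j ≤ n` contribute to the coefficient
of `x^n`. -/
noncomputable def logMultisetSeries (c : ℕ → ℝ) (y : ℝ) : PowerSeries ℝ :=
  PowerSeries.mk fun n => ∑ j ∈ Finset.Icc 1 n,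
    PowerSeries.coeff n ((genSeries c).subst (PowerSeries.X ^ j : PowerSeries ℝ)) * y ^ j / j

theorem hasSubst_logMultisetSeries (c : ℕ → ℝ) (y : ℝ) :
    PowerSeries.HasSubst (logMultisetSeries c y) :=
  PowerSeries.HasSubst.of_constantCoeff_zero' (by
    rw [← PowerSeries.coeff_zero_eq_constantCoeff_apply, logMultisetSeries, PowerSeries.coeff_mk]
    simp)

/-- The formal power series `G(x,y) = exp (∑_{j ≥ 1} C(x^j) y^j / j)` in `x`,
for a real number `y`. -/
noncomputable def multisetSeries (c : ℕ → ℝ) (y : ℝ) : PowerSeries ℝ :=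
  (PowerSeries.exp ℝ).subst (logMultisetSeries c y)

/-- The number `G^{≥2}(x,y) = exp (∑_{j ≥ 2} C(x^j) y^j / j)`, the sum being indexed
by `j = i + 2`. -/
noncomputable def multisetTail (c : ℕ → ℝ) (x y : ℝ) : ℝ :=
  Real.exp (∑' i : ℕ, genFun c (x ^ (i + 2)) / ((i + 2 : ℕ) : ℝ) * y ^ (i + 2))

/-! The proof is the saddle-point method on the circle of radius `z = ρ * exp (-1 / x)`. On it,
`G(w,1)` factors as `exp (C(w))` times `exp (logTail c w)`. The powers `w ^ j` with `j ≥ 2` stay in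
the disc of radius `ρ ^ 2 < ρ`, so the second factor is continuous up to `|w| = ρ` and only its
value at `ρ` survives in the limit. The first factor carries the asymptotics.

Put `a k = c k * ρ ^ k = h k * k ^ (α - 1)` and let `M m` be the sum of `k ^ m * a k * exp (-k /
x)`. Potter's bound shows that `M m` has order `H x * x ^ m` for `m ≥ 1`, where `H x = h x * x ^ α`
grows at least like a positive power. This is abstracted into `HasPowerScale`, which is all that the
analysis uses.

The saddle equation says `M 1 = n`, so the factor `exp (-i n θ)` in Cauchy's formula cancels the
linear phase of `C` (`IsExpansive.integral_eq`). After the substitution `θ = t / √(M 2)` the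
exponent tends to `-t ^ 2 / 2`, because `M 3 / (M 2) ^ (3/2)` is `O(H x ^ (-1/2))`. The bound
`exp_neg_expDecay_le` supplies one integrable majorant for central and outer arcs alike, so
dominated convergence gives the Gaussian integral (`HasPowerScale.tendsto_integral`). Finally `z ^ 2
* C''(z) = M 2 - M 1`, and `M 1 / M 2 → 0` lets it replace `M 2`. -/

/-! ### Slowly varying functions: uniform convergence and Potter's bound. -/

/-- The uniform convergence theorem for slowly varying functions, in additive form. -/
theorem eventually_forall_abs_sub_le_of_tendsto_sub {g : ℝ → ℝ} (hg : Continuous g)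
    (hlim : ∀ u : ℝ, Tendsto (fun x => g (x + u) - g x) atTop (𝓝 0)) {ε : ℝ} (hε : 0 < ε) :
    ∀ᶠ x in atTop, ∀ u ∈ Set.Icc (0 : ℝ) 1, |g (x + u) - g x| ≤ ε := by
  have hε3 : 0 < ε / 3 := by positivity
  -- Baire category: these closed sets cover the line, so one of them contains a ball around some
  -- `a`.
  let E : ℕ → Set ℝ := fun N => {u | ∀ x : ℝ, N ≤ x → |g (x + u) - g x| ≤ ε / 3}
  have hE : ∀ N, IsClosed (E N) := by
    intro N
    have : E N = ⋂ x : ℝ, ⋂ _ : (N : ℝ) ≤ x, {u | |g (x + u) - g x| ≤ ε / 3} := by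
      ext u; simp [E]
    rw [this]
    refine isClosed_iInter fun x => isClosed_iInter fun _ => ?_
    exact isClosed_le (by fun_prop) continuous_const
  have hsmall : ∀ u : ℝ, ∀ᶠ x in atTop, |g (x + u) - g x| ≤ ε / 3 := by
    intro u
    have := (hlim u).eventually (Metric.closedBall_mem_nhds 0 hε3)
    filter_upwards [this] with x hx
    simpa [Real.dist_eq] using hx
  have hU : ⋃ N, E N = Set.univ := by
    refine Set.eq_univ_of_forall fun u => ?_
    obtain ⟨X, hX⟩ := eventually_atTop.1 (hsmall u)
    obtain ⟨N, hN⟩ := exists_nat_ge X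
    exact Set.mem_iUnion.2 ⟨N, fun x hx => hX x (hN.trans hx)⟩
  obtain ⟨N, a, ha⟩ := nonempty_interior_of_iUnion_of_closed hE hU
  obtain ⟨d, hd, hball⟩ := Metric.mem_nhds_iff.1 (mem_interior_iff_mem_nhds.1 ha)
  -- An increment by a small `u` is the difference of the increments by `a + u` and by `a` from the
  -- base point `x - a`, and both lie in the ball.
  have hstep : ∀ x : ℝ, N + |a| ≤ x → ∀ u : ℝ, 0 ≤ u → u < d →
      |g (x + u) - g x| ≤ 2 * (ε / 3) := by
    intro x hx u hu hud
    have hxa : (N : ℝ) ≤ x - a := by linarith [le_abs_self a]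
    have h1 := hball (show a + u ∈ Metric.ball a d by simp [abs_of_nonneg hu, hud]) (x - a) hxa
    have h2 := hball (show a ∈ Metric.ball a d by simp [hd]) (x - a) hxa
    rw [show x - a + (a + u) = x + u by ring] at h1
    rw [show x - a + a = x by ring] at h2
    rw [abs_le] at *
    constructor <;> linarith [h1.1, h1.2, h2.1, h2.2]
  -- Each `u` in `[0, 1]` is a point of the finite grid of mesh `d / 2`, costing `ε / 3`, plus a
  -- remainder below `d`, costing `2 * (ε / 3)`.
  have hd2 : 0 < d / 2 := by positivity
  have hfin : ∀ᶠ x in atTop, ∀ j ∈ Finset.range (⌊1 / (d / 2)⌋₊ + 1),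
      |g (x + j * (d / 2)) - g x| ≤ ε / 3 :=
    (Finset.eventually_all _).2 fun j _ => hsmall _
  filter_upwards [hfin, eventually_ge_atTop ((N : ℝ) + |a|)] with x hx hxN u hu
  have hj : ⌊u / (d / 2)⌋₊ ∈ Finset.range (⌊1 / (d / 2)⌋₊ + 1) := by
    rw [Finset.mem_range, Nat.lt_succ_iff]
    exact Nat.floor_le_floor (by gcongr; exact hu.2)
  have hle : (⌊u / (d / 2)⌋₊ : ℝ) * (d / 2) ≤ u := by
    rw [← le_div_iff₀ hd2]; exact Nat.floor_le (div_nonneg hu.1 hd2.le)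
  have hlt : u < ((⌊u / (d / 2)⌋₊ : ℝ) + 1) * (d / 2) := by
    rw [← div_lt_iff₀ hd2]; exact Nat.lt_floor_add_one _
  have h1 := hx _ hj
  have h2 := hstep (x + ⌊u / (d / 2)⌋₊ * (d / 2))
    (by have : (0 : ℝ) ≤ ⌊u / (d / 2)⌋₊ * (d / 2) := by positivity
        linarith) (u - ⌊u / (d / 2)⌋₊ * (d / 2)) (by linarith) (by nlinarith)
  rw [show x + ⌊u / (d / 2)⌋₊ * (d / 2) + (u - ⌊u / (d / 2)⌋₊ * (d / 2)) = x + u by ring] at h2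
  rw [abs_le] at *
  constructor <;> linarith [h1.1, h1.2, h2.1, h2.2]

/-- Telescope over unit steps, each costing `η`; the fractional part of `y - x` costs one more `η`.
-/
theorem exists_forall_abs_sub_le_mul_of_tendsto_sub {g : ℝ → ℝ} (hg : Continuous g)
    (hlim : ∀ u : ℝ, Tendsto (fun x => g (x + u) - g x) atTop (𝓝 0)) {η : ℝ} (hη : 0 < η) :
    ∃ X : ℝ, ∀ x, X ≤ x → ∀ y, X ≤ y → |g y - g x| ≤ η * (1 + |y - x|) := by
  obtain ⟨X, hX⟩ := eventually_atTop.1 (eventually_forall_abs_sub_le_of_tendsto_sub hg hlim hη)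
  have hnat : ∀ n : ℕ, ∀ x, X ≤ x → |g (x + n) - g x| ≤ η * n := by
    intro n
    induction n with
    | zero => intro x _; simp
    | succ n ih =>
      intro x hx
      have h1 := ih x hx
      have h2 := hX (x + n) (by have := n.cast_nonneg (α := ℝ); linarith) 1 (by simp)
      push_cast
      rw [← add_assoc]
      rw [abs_le] at *
      constructor <;> linarith [h1.1, h1.2, h2.1, h2.2]
  have key : ∀ x, X ≤ x → ∀ y, x ≤ y → |g y - g x| ≤ η * (1 + |y - x|) := by
    intro x hx y hxy
    have h0 : 0 ≤ y - x := by linarith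
    have hfl := Nat.floor_le h0
    have hfl' := Nat.lt_floor_add_one (y - x)
    have h1 := hnat ⌊y - x⌋₊ x hx
    have h2 := hX (x + ⌊y - x⌋₊) (by have := (⌊y - x⌋₊).cast_nonneg (α := ℝ); linarith)
      (y - x - ⌊y - x⌋₊) ⟨by linarith, by linarith⟩
    rw [show x + ⌊y - x⌋₊ + (y - x - ⌊y - x⌋₊) = y by ring] at h2
    rw [abs_of_nonneg h0]
    have h3 : η * ⌊y - x⌋₊ ≤ η * (y - x) := by gcongr
    rw [abs_le] at *
    constructor <;> linarith [h1.1, h1.2, h2.1, h2.2]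
  refine ⟨X, fun x hx y hy => ?_⟩
  rcases le_total x y with h | h
  · exact key x hx y h
  · rw [abs_sub_comm, abs_sub_comm y x]; exact key y hy x h

/-- Potter's bound for slowly varying functions. -/
theorem IsSlowlyVarying.exists_potter {h : ℝ → ℝ} (hh : IsSlowlyVarying h) {η : ℝ} (hη : 0 < η) :
    ∃ X : ℝ, 1 ≤ X ∧ (∀ x, X ≤ x → 0 < h x) ∧ ∀ x, X ≤ x → ∀ y, X ≤ y →
      |Real.log (h y) - Real.log (h x)| ≤ η * (1 + |Real.log y - Real.log x|) := by
  obtain ⟨X₀, hX₀⟩ := eventually_atTop.1 hh.eventually_pos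
  set Y : ℝ := Real.log (max X₀ 1) with hY
  have hpos : (0 : ℝ) < max X₀ 1 := by positivity
  have hYexp : Real.exp Y = max X₀ 1 := Real.exp_log hpos
  have hmem : ∀ x, Y ≤ x → 1 ≤ Real.exp x ∧ 0 < h (Real.exp x) := by
    intro x hx
    have : max X₀ 1 ≤ Real.exp x := by rw [← hYexp]; exact Real.exp_le_exp.2 hx
    exact ⟨(le_max_right _ _).trans this, hX₀ _ ((le_max_left _ _).trans this)⟩
  -- The truncation at `Y` makes `g` continuous on the whole line without changing it near infinity.
  let g : ℝ → ℝ := fun x => Real.log (h (Real.exp (max x Y)))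
  have hg : Continuous g := by
    refine Continuous.log ?_ fun x => (hmem _ (le_max_right _ _)).2.ne'
    exact hh.continuousOn.comp_continuous (by fun_prop) fun x => (hmem _ (le_max_right _ _)).1
  have hlim : ∀ u : ℝ, Tendsto (fun x => g (x + u) - g x) atTop (𝓝 0) := by
    intro u
    have h1 := ((hh.tendsto_ratio _ (Real.exp_pos u)).comp Real.tendsto_exp_atTop)
    have h2 := (Real.continuousAt_log one_ne_zero).tendsto.comp h1
    rw [Real.log_one] at h2
    refine h2.congr' ?_
    filter_upwards [eventually_ge_atTop Y, eventually_ge_atTop (Y - u)] with x hx hxu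
    have hxu' : Y ≤ x + u := by linarith
    simp only [Function.comp, g, max_eq_left hx, max_eq_left hxu']
    rw [mul_comm, ← Real.exp_add, Real.log_div (hmem _ hxu').2.ne' (hmem _ hx).2.ne']
  obtain ⟨X, hX⟩ := exists_forall_abs_sub_le_mul_of_tendsto_sub hg hlim hη
  refine ⟨max (Real.exp X) (max X₀ 1), by simp, fun x hx => hX₀ x ?_, fun x hx y hy => ?_⟩
  · exact (le_max_left _ _).trans ((le_max_right _ _).trans hx)
  · have aux : ∀ x, max (Real.exp X) (max X₀ 1) ≤ x →
        0 < x ∧ X ≤ Real.log x ∧ Y ≤ Real.log x := by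
      intro x hx
      have hx0 : 0 < x := (by positivity : 0 < max (Real.exp X) (max X₀ 1)).trans_le hx
      exact ⟨hx0, (Real.le_log_iff_exp_le hx0).2 ((le_max_left _ _).trans hx),
        Real.log_le_log hpos ((le_max_right _ _).trans hx)⟩
    obtain ⟨hx0, hx1, hx2⟩ := aux x hx
    obtain ⟨hy0, hy1, hy2⟩ := aux y hy
    have := hX _ hx1 _ hy1
    simpa only [g, max_eq_left hx2, max_eq_left hy2, Real.exp_log hx0, Real.exp_log hy0] using this

/-! ### Power scales, and their verification for regularly varying sequences. -/

/-- The sequence `a` has power growth with respect to the scale function `H`: the weights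
`k ^ (m + 1) * a k * exp (-k / x)` are controlled by `H x * x ^ m`, with matching lower bounds for
`x ≤ k ≤ 16 x`, and `H` grows at least like a positive power. -/
structure HasPowerScale (a : ℕ → ℝ) (H : ℝ → ℝ) : Prop where
  zero : a 0 = 0
  nonneg : ∀ k, 0 ≤ a k
  upper : ∀ m : ℕ, ∃ K : ℝ, ∀ᶠ x : ℝ in atTop, ∀ k : ℕ,
    (k : ℝ) ^ (m + 1) * a k * Real.exp (-k / x) ≤ K * (H x * x ^ m) * Real.exp (-k / (2 * x))
  lower : ∃ c : ℝ, 0 < c ∧ ∀ᶠ x : ℝ in atTop, ∀ k : ℕ, x ≤ k → (k : ℝ) ≤ 16 * x →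
    c * H x ≤ x * (a k * Real.exp (-k / x))
  growth : ∃ β : ℝ, 0 < β ∧ ∀ᶠ x : ℝ in atTop, x ^ β ≤ H x

/-- Raise `v ≤ exp v` at `v = u / (2 * p)` to the power `p`. -/
theorem Real.rpow_le_mul_exp_half {p : ℝ} (hp : 0 < p) {u : ℝ} (hu : 0 < u) :
    u ^ p ≤ (2 * p) ^ p * Real.exp (u / 2) := by
  have h1 : u / (2 * p) ≤ Real.exp (u / (2 * p)) := by
    linarith [Real.add_one_le_exp (u / (2 * p))]
  have h2 : (u / (2 * p)) ^ p ≤ (Real.exp (u / (2 * p))) ^ p :=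
    Real.rpow_le_rpow (by positivity) h1 hp.le
  rw [← Real.exp_mul, Real.div_rpow hu.le (by positivity),
    div_le_iff₀ (by positivity), show u / (2 * p) * p = u / 2 by field_simp] at h2
  linarith

theorem Real.exp_mul_abs_log_le {η u : ℝ} (hu : 0 < u) :
    Real.exp (η * |Real.log u|) ≤ u ^ η + u ^ (-η) := by
  rw [Real.rpow_def_of_pos hu, Real.rpow_def_of_pos hu]
  rcases abs_cases (Real.log u) with ⟨h, _⟩ | ⟨h, _⟩ <;> rw [h]
  · rw [mul_comm]; linarith [Real.exp_pos (Real.log u * -η)]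
  · rw [show η * -Real.log u = Real.log u * -η by ring]
    linarith [Real.exp_pos (Real.log u * η)]

/-- Potter's bound with exponent `α / 4`, taken from a fixed base point, lets `h` decay no faster
than a constant times `x ^ (-α / 4)`. -/
theorem IsSlowlyVarying.growth {h : ℝ → ℝ} (hh : IsSlowlyVarying h) {α : ℝ} (hα : 0 < α) :
    ∀ᶠ x : ℝ in atTop, x ^ (α / 2) ≤ h x * x ^ α := by
  obtain ⟨X, hX1, hpos, hpot⟩ := hh.exists_potter (show 0 < α / 4 by positivity)
  have hlog : ∀ᶠ x : ℝ in atTop, (α / 4 - Real.log (h X)) / (α / 4) ≤ Real.log x :=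
    Real.tendsto_log_atTop.eventually_ge_atTop _
  filter_upwards [hlog, eventually_ge_atTop X] with x hx hXx
  have hx0 : 0 < x := by linarith
  have h1 := (abs_le.1 (hpot X le_rfl x hXx)).1
  have h2 : Real.log X ≤ Real.log x := Real.log_le_log (by linarith) hXx
  have h3 : 0 ≤ Real.log X := Real.log_nonneg hX1
  rw [abs_of_nonneg (by linarith)] at h1
  rw [div_le_iff₀ (by positivity)] at hx
  rw [← Real.log_le_log_iff (by positivity) (mul_pos (hpos x hXx) (by positivity)),
    Real.log_mul (hpos x hXx).ne' (by positivity), Real.log_rpow hx0, Real.log_rpow hx0]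
  nlinarith [mul_nonneg hα.le h3]

theorem IsSlowlyVarying.upper {h : ℝ → ℝ} (hh : IsSlowlyVarying h) {α : ℝ} (hα : 0 < α)
    {a : ℕ → ℝ} (ha : ∀ k : ℕ, 1 ≤ k → a k = h k * (k : ℝ) ^ (α - 1)) (m : ℕ) :
    ∃ K : ℝ, ∀ᶠ x : ℝ in atTop, ∀ k : ℕ,
      (k : ℝ) ^ (m + 1) * a k * Real.exp (-k / x) ≤
        K * (h x * x ^ α * x ^ m) * Real.exp (-k / (2 * x)) := by
  have hη : 0 < α / 4 := by positivity
  obtain ⟨X, hX1, hpos, hpot⟩ := hh.exists_potter hη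
  -- With `u = k / x`, Potter's bound costs a factor `u ^ (± α / 4)`, which produces these two
  -- exponents. Both are positive, so the powers of `u` are absorbed by half of the exponential
  -- decay.
  set p : ℝ := m + α + α / 4
  set q : ℝ := m + α - α / 4
  have hp : 0 < p := by positivity
  have hq : 0 < q := by have := m.cast_nonneg (α := ℝ); simp only [q]; linarith
  set K₁ : ℝ := Real.exp (α / 4) * ((2 * p) ^ p + (2 * q) ^ q)
  have hK₁ : 0 ≤ K₁ := by positivity
  -- The finitely many `k < X`, out of reach of Potter's bound, are paid for by a constant, since `h
  -- x * x ^ α * x ^ m ≥ 1` eventually.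
  set K₂ : ℝ := ∑ k ∈ Finset.range ⌈X⌉₊, |(k : ℝ) ^ (m + 1) * a k|
  have hK₂ : 0 ≤ K₂ := Finset.sum_nonneg fun _ _ => abs_nonneg _
  refine ⟨K₁ + K₂, ?_⟩
  filter_upwards [eventually_ge_atTop X, hh.growth hα] with x hx hgr k
  have hx1 : 1 ≤ x := hX1.trans hx
  have hx0 : 0 < x := by linarith
  have hH1 : 1 ≤ h x * x ^ α := (Real.one_le_rpow hx1 (by positivity)).trans hgr
  have hHm : 1 ≤ h x * x ^ α * x ^ m := one_le_mul_of_one_le_of_one_le hH1 (one_le_pow₀ hx1)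
  have hexp : Real.exp (-k / x) ≤ Real.exp (-k / (2 * x)) := by
    rw [Real.exp_le_exp, neg_div, neg_div, neg_le_neg_iff]
    gcongr
    linarith
  rcases lt_or_ge (k : ℝ) X with hk | hk
  · have hkm : k ∈ Finset.range ⌈X⌉₊ := Finset.mem_range.2 (Nat.lt_ceil.2 hk)
    have h1 : (k : ℝ) ^ (m + 1) * a k ≤ K₂ := (le_abs_self _).trans
      (Finset.single_le_sum (f := fun k : ℕ => |(k : ℝ) ^ (m + 1) * a k|)
        (fun _ _ => abs_nonneg _) hkm)
    calc (k : ℝ) ^ (m + 1) * a k * Real.exp (-k / x)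
        ≤ K₂ * Real.exp (-k / (2 * x)) := by gcongr
      _ ≤ (K₁ + K₂) * (h x * x ^ α * x ^ m) * Real.exp (-k / (2 * x)) := by
        gcongr
        nlinarith
  · have hk0 : (0 : ℝ) < k := by linarith
    have hk1 : 1 ≤ k := by exact_mod_cast hk0
    have hpk := (abs_le.1 (hpot x hx k hk)).2
    rw [← Real.log_div hk0.ne' hx0.ne'] at hpk
    have hpos' := hpos x hx
    set u : ℝ := k / x with hu
    have hu0 : 0 < u := by positivity
    have hkx : (k : ℝ) = x * u := by rw [hu]; field_simp
    have h1 : h k ≤ h x * (Real.exp (α / 4) * (u ^ (α / 4) + u ^ (-(α / 4)))) := by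
      calc h k = Real.exp (Real.log (h k)) := (Real.exp_log (hpos _ hk)).symm
        _ ≤ Real.exp (Real.log (h x) + (α / 4 + α / 4 * |Real.log u|)) := by
          rw [Real.exp_le_exp]; linarith
        _ = h x * (Real.exp (α / 4) * Real.exp (α / 4 * |Real.log u|)) := by
          rw [Real.exp_add, Real.exp_add, Real.exp_log (hpos x hx)]
        _ ≤ _ := by
          gcongr
          exact Real.exp_mul_abs_log_le hu0
    have h2 : (k : ℝ) ^ (m + 1) * (k : ℝ) ^ (α - 1) = x ^ α * x ^ m * u ^ (m + α) := by
      rw [← Real.rpow_natCast (k : ℝ), ← Real.rpow_add hk0, ← Real.rpow_natCast x,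
        ← Real.rpow_add hx0, hkx, Real.mul_rpow hx0.le hu0.le]
      push_cast
      ring_nf
    have h3 : u ^ (m + α) * (u ^ (α / 4) + u ^ (-(α / 4))) = u ^ p + u ^ q := by
      rw [mul_add, ← Real.rpow_add hu0, ← Real.rpow_add hu0]
      rfl
    have h4 : u ^ p + u ^ q ≤ ((2 * p) ^ p + (2 * q) ^ q) * Real.exp (u / 2) := by
      linarith [Real.rpow_le_mul_exp_half hp hu0, Real.rpow_le_mul_exp_half hq hu0]
    have h5 : Real.exp (u / 2) * Real.exp (-k / x) = Real.exp (-k / (2 * x)) := by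
      rw [← Real.exp_add, hu]; congr 1; field_simp; ring
    calc (k : ℝ) ^ (m + 1) * a k * Real.exp (-k / x)
        = h k * (x ^ α * x ^ m * u ^ (m + α)) * Real.exp (-k / x) := by
          rw [ha k hk1, ← h2]; ring
      _ ≤ h x * (Real.exp (α / 4) * (u ^ (α / 4) + u ^ (-(α / 4)))) *
            (x ^ α * x ^ m * u ^ (m + α)) * Real.exp (-k / x) := by gcongr
      _ = Real.exp (α / 4) * (h x * x ^ α * x ^ m) * (u ^ p + u ^ q) * Real.exp (-k / x) := by
          rw [← h3]; ring
      _ ≤ Real.exp (α / 4) * (h x * x ^ α * x ^ m) *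
            (((2 * p) ^ p + (2 * q) ^ q) * Real.exp (u / 2)) * Real.exp (-k / x) := by gcongr
      _ = K₁ * (h x * x ^ α * x ^ m) * Real.exp (-k / (2 * x)) := by
          rw [← h5]; ring
      _ ≤ _ := by gcongr; linarith

theorem IsSlowlyVarying.lower {h : ℝ → ℝ} (hh : IsSlowlyVarying h) {α : ℝ} (hα : 0 < α)
    {a : ℕ → ℝ} (ha : ∀ k : ℕ, 1 ≤ k → a k = h k * (k : ℝ) ^ (α - 1)) :
    ∃ c : ℝ, 0 < c ∧ ∀ᶠ x : ℝ in atTop, ∀ k : ℕ, x ≤ k → (k : ℝ) ≤ 16 * x →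
      c * (h x * x ^ α) ≤ x * (a k * Real.exp (-k / x)) := by
  obtain ⟨X, hX1, hpos, hpot⟩ := hh.exists_potter one_pos
  -- With `1 ≤ u = k / x ≤ 16`, the three factors bound `h k / h x` (Potter with `η = 1`), `u ^ (α -
  -- 1) ≥ u⁻¹` and `exp (-u)` from below.
  refine ⟨Real.exp (-(1 + Real.log 16)) * (16⁻¹ * Real.exp (-16)), by positivity, ?_⟩
  filter_upwards [eventually_ge_atTop X] with x hx k hxk hk
  have hx0 : 0 < x := by linarith
  have hk0 : (0 : ℝ) < k := by linarith
  have hk1 : 1 ≤ k := by exact_mod_cast hk0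
  have hpk := (abs_le.1 (hpot x hx k (hx.trans hxk))).1
  rw [← Real.log_div hk0.ne' hx0.ne'] at hpk
  have hpos' := hpos x hx
  set u : ℝ := k / x with hu
  have hu1 : 1 ≤ u := by rw [hu, le_div_iff₀ hx0]; linarith
  have hu16 : u ≤ 16 := by rw [hu, div_le_iff₀ hx0]; linarith
  have hu0 : 0 < u := by positivity
  have hkx : (k : ℝ) = x * u := by rw [hu]; field_simp
  rw [abs_of_nonneg (Real.log_nonneg hu1)] at hpk
  have h1 : Real.exp (-(1 + Real.log 16)) * h x ≤ h k := by
    rw [← Real.exp_log (hpos _ (hx.trans hxk)), ← Real.exp_log hpos', ← Real.exp_add,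
      Real.exp_le_exp]
    linarith [Real.log_le_log hu0 hu16]
  have h2 : 16⁻¹ * x ^ α ≤ x * (k : ℝ) ^ (α - 1) := by
    have : (16 : ℝ)⁻¹ ≤ u ^ (α - 1) := by
      calc (16 : ℝ)⁻¹ ≤ u⁻¹ := by gcongr
        _ = u ^ (-1 : ℝ) := (Real.rpow_neg_one u).symm
        _ ≤ u ^ (α - 1) := Real.rpow_le_rpow_of_exponent_le hu1 (by linarith)
    rw [hkx, Real.mul_rpow hx0.le hu0.le, Real.rpow_sub_one hx0.ne']
    have hxα : 0 ≤ x ^ α := by positivity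
    calc 16⁻¹ * x ^ α ≤ u ^ (α - 1) * x ^ α := by gcongr
      _ = _ := by field_simp
  have h3 : Real.exp (-16) ≤ Real.exp (-k / x) := by
    rw [Real.exp_le_exp, neg_div]; linarith
  rw [ha k hk1]
  have h0 : 0 ≤ h k := (hpos _ (hx.trans hxk)).le
  calc _ = (Real.exp (-(1 + Real.log 16)) * h x) * (16⁻¹ * x ^ α) * Real.exp (-16) := by ring
    _ ≤ h k * (x * (k : ℝ) ^ (α - 1)) * Real.exp (-k / x) := by gcongr
    _ = _ := by ring

theorem IsSlowlyVarying.hasPowerScale {h : ℝ → ℝ} (hh : IsSlowlyVarying h) {α : ℝ} (hα : 0 < α)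
    {a : ℕ → ℝ} (ha0 : a 0 = 0) (ha : ∀ k : ℕ, 1 ≤ k → a k = h k * (k : ℝ) ^ (α - 1)) :
    HasPowerScale a fun x => h x * x ^ α where
  zero := ha0
  nonneg k := by
    rcases Nat.eq_zero_or_pos k with rfl | hk
    · exact ha0.ge
    · rw [ha k hk]
      exact mul_nonneg (hh.nonneg _ (by exact_mod_cast hk)) (by positivity)
  upper := hh.upper hα ha
  lower := hh.lower hα ha
  growth := ⟨α / 2, by positivity, hh.growth hα⟩

/-! ### Two-sided bounds for the exponential moments. -/

/-- The exponential moment `∑ k ^ m * a k * exp (-k / x)`. -/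
noncomputable def expMoment (a : ℕ → ℝ) (m : ℕ) (x : ℝ) : ℝ :=
  ∑' k : ℕ, (k : ℝ) ^ m * a k * Real.exp (-k / x)

namespace HasPowerScale

variable {a : ℕ → ℝ} {H : ℝ → ℝ}

theorem summable_succ (ha : HasPowerScale a H) (m : ℕ) {x : ℝ} (hx : 0 < x) :
    Summable fun k : ℕ => (k : ℝ) ^ (m + 1) * a k * Real.exp (-k / x) := by
  obtain ⟨K, hK⟩ := ha.upper m
  -- `upper` is only available at large scales; the weights at a larger scale `y` dominate those at
  -- `x`.
  obtain ⟨y, hy, hxy⟩ := (hK.and (eventually_ge_atTop x)).exists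
  have hy0 : 0 < y := by linarith
  refine Summable.of_nonneg_of_le
    (fun k => by have := ha.nonneg k; positivity) (fun k => ?_)
    ((Real.summable_exp_nat_mul_iff (a := -1 / (2 * y)) |>.2
      (by rw [neg_div]; exact neg_neg_of_pos (by positivity))).mul_left (K * (H y * y ^ m)))
  have h0 := ha.nonneg k
  have h1 := hy k
  calc (k : ℝ) ^ (m + 1) * a k * Real.exp (-k / x)
      ≤ (k : ℝ) ^ (m + 1) * a k * Real.exp (-k / y) := by
        gcongr ?_ * Real.exp ?_
        rw [neg_div, neg_div, neg_le_neg_iff]; gcongr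
    _ ≤ _ := h1.trans (le_of_eq (by congr 2; ring))

/-- Covers `m = 0`, which `upper` leaves out: for `α < 1` a pointwise bound without the factor `k`
can fail at small `k`. Since `a 0 = 0`, a spare factor `k ≥ 1` is harmless for summability. -/
theorem summable (ha : HasPowerScale a H) (m : ℕ) {x : ℝ} (hx : 0 < x) :
    Summable fun k : ℕ => (k : ℝ) ^ m * a k * Real.exp (-k / x) := by
  refine Summable.of_nonneg_of_le (fun k => by have := ha.nonneg k; positivity) (fun k => ?_)
    (ha.summable_succ m hx)
  rcases Nat.eq_zero_or_pos k with rfl | hk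
  · simp [ha.zero]
  · have h0 := ha.nonneg k
    have hk1 : (1 : ℝ) ≤ k := by exact_mod_cast hk
    gcongr ?_ * _ * _
    exact pow_le_pow_right₀ hk1 m.le_succ

theorem expMoment_nonneg (ha : HasPowerScale a H) (m : ℕ) (x : ℝ) : 0 ≤ expMoment a m x :=
  tsum_nonneg fun k => by have := ha.nonneg k; positivity

theorem growth_tendsto (ha : HasPowerScale a H) : Tendsto H atTop atTop := by
  obtain ⟨β, hβ, h⟩ := ha.growth
  exact tendsto_atTop_mono' _ h (tendsto_rpow_atTop hβ)

theorem expMoment_upper (ha : HasPowerScale a H) (m : ℕ) :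
    ∃ K : ℝ, 0 < K ∧ ∀ᶠ x : ℝ in atTop, expMoment a (m + 1) x ≤ K * (H x * x ^ (m + 1)) := by
  obtain ⟨K, hK⟩ := ha.upper m
  refine ⟨|K| * 4 + 1, by positivity, ?_⟩
  filter_upwards [hK, eventually_ge_atTop 1, ha.growth_tendsto.eventually_ge_atTop 0]
    with x hx hx1 hH
  have hx0 : 0 < x := by linarith
  have hr : Real.exp (-1 / (2 * x)) < 1 := by
    rw [Real.exp_lt_one_iff, neg_div]; exact neg_neg_of_pos (by positivity)
  have hgeo := hasSum_geometric_of_lt_one (Real.exp_pos (-1 / (2 * x))).le hr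
  -- The geometric sum contributes one more power of `x`; the estimate is `exp (-t) ≤ 1 / (1 + t)`
  -- at `t = 1 / (2 * x)`.
  have hbound : (1 - Real.exp (-1 / (2 * x)))⁻¹ ≤ 4 * x := by
    have h1 := Real.add_one_le_exp (1 / (2 * x))
    have h2 : Real.exp (-1 / (2 * x)) ≤ (1 / (2 * x) + 1)⁻¹ := by
      rw [neg_div, Real.exp_neg]; gcongr
    have h3 : (1 / (2 * x) + 1)⁻¹ ≤ 1 - (4 * x)⁻¹ := by
      rw [inv_le_iff_one_le_mul₀ (by positivity)]
      have : (1 - (4 * x)⁻¹) * (1 / (2 * x) + 1) = 1 + (2 * x - 1) / (8 * x ^ 2) := by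
        field_simp; ring
      rw [this]
      have : 0 ≤ (2 * x - 1) / (8 * x ^ 2) := div_nonneg (by linarith) (by positivity)
      linarith
    rw [inv_le_comm₀ (by linarith) (by positivity)]
    linarith
  have hle : expMoment a (m + 1) x ≤ K * (H x * x ^ m) * (1 - Real.exp (-1 / (2 * x)))⁻¹ := by
    refine hasSum_le (fun k => ?_) (ha.summable (m + 1) hx0).hasSum (hgeo.mul_left _)
    refine (hx k).trans (le_of_eq ?_)
    rw [← Real.exp_nat_mul]
    congr 2; ring
  calc _ ≤ _ := hle
    _ ≤ |K| * (H x * x ^ m) * (4 * x) := by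
      gcongr
      exact le_abs_self K
    _ = |K| * 4 * (H x * x ^ (m + 1)) := by ring
    _ ≤ _ := by gcongr; linarith

/-- Lower bound for a weighted sum restricted to a dyadic-type block. -/
theorem sum_block_lower (ha : HasPowerScale a H) :
    ∃ c : ℝ, 0 < c ∧ ∀ᶠ x : ℝ in atTop, ∀ w : ℕ → ℝ, (∀ k, 0 ≤ w k) →
      Summable (fun k => w k * (a k * Real.exp (-k / x))) → ∀ j : ℕ, j ≤ 8 →
      c * H x / x * ∑ k ∈ Finset.Ico ⌈x⌉₊ (j * ⌈x⌉₊), w k ≤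
        ∑' k, w k * (a k * Real.exp (-k / x)) := by
  obtain ⟨c, hc, h⟩ := ha.lower
  refine ⟨c, hc, ?_⟩
  filter_upwards [h, eventually_ge_atTop 1] with x hx hx1 w hw hsum j hj
  have hx0 : 0 < x := by linarith
  refine le_trans ?_ (hsum.sum_le_tsum (Finset.Ico ⌈x⌉₊ (j * ⌈x⌉₊))
    fun k _ => mul_nonneg (hw k) (mul_nonneg (ha.nonneg k) (Real.exp_pos _).le))
  rw [Finset.mul_sum]
  refine Finset.sum_le_sum fun k hk => ?_
  rw [Finset.mem_Ico] at hk
  have h1 : x ≤ k := (Nat.le_ceil x).trans (by exact_mod_cast hk.1)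
  -- This is where the 16 of `lower` is used: `⌈x⌉₊ < x + 1 ≤ 2 * x`, so eight multiples stay within
  -- range.
  have h2 : (k : ℝ) ≤ 16 * x := by
    have h3 : (k : ℝ) ≤ 8 * ⌈x⌉₊ := by
      exact_mod_cast hk.2.le.trans (Nat.mul_le_mul_right _ hj)
    have h4 := Nat.ceil_lt_add_one hx0.le
    linarith
  rw [mul_comm]
  refine mul_le_mul_of_nonneg_left ?_ (hw k)
  rw [div_le_iff₀ hx0]
  linarith [hx k h1 h2]

theorem expMoment_lower (ha : HasPowerScale a H) (m : ℕ) :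
    ∃ c : ℝ, 0 < c ∧ ∀ᶠ x : ℝ in atTop, c * (H x * x ^ m) ≤ expMoment a m x := by
  obtain ⟨c, hc, h⟩ := ha.sum_block_lower
  refine ⟨c, hc, ?_⟩
  filter_upwards [h, eventually_ge_atTop 1, ha.growth_tendsto.eventually_ge_atTop 0]
    with x hx hx1 hH
  have hx0 : 0 < x := by linarith
  have h1 := hx (fun k => (k : ℝ) ^ m) (fun k => by positivity)
    (by simpa only [mul_assoc] using ha.summable m hx0) 2 (by norm_num)
  simp only [← mul_assoc] at h1
  refine le_trans ?_ h1
  -- The block has `⌈x⌉₊` terms, each at least `x ^ m`.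
  have h2 : ⌈x⌉₊ * x ^ m ≤ ∑ k ∈ Finset.Ico ⌈x⌉₊ (2 * ⌈x⌉₊), (k : ℝ) ^ m := by
    have := Finset.card_nsmul_le_sum (Finset.Ico ⌈x⌉₊ (2 * ⌈x⌉₊)) (fun k : ℕ => (k : ℝ) ^ m)
      (x ^ m) (fun k hk => by
        rw [Finset.mem_Ico] at hk
        have : x ≤ k := (Nat.le_ceil x).trans (by exact_mod_cast hk.1)
        gcongr)
    rw [Nat.card_Ico, nsmul_eq_mul, show 2 * ⌈x⌉₊ - ⌈x⌉₊ = ⌈x⌉₊ by omega] at this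
    exact this
  calc c * (H x * x ^ m) = c * H x / x * (x * x ^ m) := by field_simp
    _ ≤ c * H x / x * (⌈x⌉₊ * x ^ m) := by gcongr; exact Nat.le_ceil x
    _ ≤ _ := by gcongr

end HasPowerScale

/-! ### Behaviour on the circle: Taylor expansion at the saddle and decay away from it. -/

theorem Real.two_mul_sin_half_mul_sum_cos (θ : ℝ) {m n : ℕ} (hmn : m ≤ n) :
    2 * Real.sin (θ / 2) * ∑ k ∈ Finset.Ico m n, Real.cos (k * θ) =
      Real.sin (n * θ - θ / 2) - Real.sin (m * θ - θ / 2) := by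
  induction n, hmn using Nat.le_induction with
  | base => simp
  | succ n hmn ih =>
    rw [Finset.sum_Ico_succ_top hmn, mul_add, ih]
    have : ((n + 1 : ℕ) : ℝ) * θ - θ / 2 = n * θ + θ / 2 := by push_cast; ring
    rw [this, Real.sin_add, Real.sin_sub (n * θ)]
    ring

/-- The Dirichlet kernel bound: the telescoped sum is at most `1 / |sin (θ / 2)|`, and Jordan's
inequality gives `|θ| ≤ π * |sin (θ / 2)|`. -/
theorem Real.abs_mul_sum_cos_le {θ : ℝ} (hθ : |θ| ≤ Real.pi) {m n : ℕ} (hmn : m ≤ n) :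
    |θ| * ∑ k ∈ Finset.Ico m n, Real.cos (k * θ) ≤ Real.pi := by
  rcases le_or_gt (∑ k ∈ Finset.Ico m n, Real.cos (k * θ)) 0 with h | h
  · exact (mul_nonpos_of_nonneg_of_nonpos (abs_nonneg _) h).trans Real.pi_pos.le
  · have h1 : 2 / Real.pi * |θ / 2| ≤ |Real.sin (θ / 2)| := Real.mul_abs_le_abs_sin (by
      rw [abs_div, abs_two]; linarith)
    have h2 := congrArg abs (Real.two_mul_sin_half_mul_sum_cos θ hmn)
    rw [abs_mul, abs_mul, abs_two, abs_of_pos h] at h2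
    have h3 : |Real.sin (n * θ - θ / 2) - Real.sin (m * θ - θ / 2)| ≤ 2 := by
      rw [abs_le]
      constructor <;> linarith [Real.sin_le_one (n * θ - θ / 2), Real.neg_one_le_sin (n * θ - θ / 2),
        Real.sin_le_one (m * θ - θ / 2), Real.neg_one_le_sin (m * θ - θ / 2)]
    rw [abs_div, abs_two] at h1
    have h4 : |θ| ≤ Real.pi * |Real.sin (θ / 2)| := by
      have hpi := Real.pi_pos
      calc |θ| = Real.pi * (2 / Real.pi * (|θ| / 2)) := by field_simp
        _ ≤ _ := by gcongr
    calc _ ≤ Real.pi * |Real.sin (θ / 2)| * ∑ k ∈ Finset.Ico m n, Real.cos (k * θ) := by gcongr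
      _ ≤ Real.pi := by nlinarith [Real.pi_pos]

/-- For `|t| ≤ 1` this is the exponential remainder; for `|t| ≥ 1` the cubic dominates every term
separately. A bound for all real `t` is needed because it is applied at `t = k * θ` and summed over
all `k`. -/
theorem Complex.norm_exp_I_mul_sub_taylor_le (t : ℝ) :
    ‖Complex.exp (Complex.I * t) - 1 - Complex.I * t + t ^ 2 / 2‖ ≤ 4 * |t| ^ 3 := by
  have hI : ‖Complex.I * (t : ℂ)‖ = |t| := by simp
  rcases le_total |t| 1 with ht | ht
  · have h := Complex.norm_exp_sub_sum_le_norm_mul_exp (Complex.I * t) 3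
    rw [hI] at h
    have h1 : Complex.exp (Complex.I * t) - 1 - Complex.I * t + t ^ 2 / 2 =
        Complex.exp (Complex.I * t) -
          ∑ m ∈ Finset.range 3, (Complex.I * (t : ℂ)) ^ m / (m.factorial : ℂ) := by
      simp only [Finset.sum_range_succ, Finset.sum_range_zero, mul_pow, Complex.I_sq]
      simp [Nat.factorial]
      ring
    rw [h1]
    refine h.trans ?_
    have h2 : Real.exp |t| ≤ 4 :=
      (Real.exp_le_exp.2 ht).trans (by linarith [Real.exp_one_lt_d9])
    nlinarith [pow_nonneg (abs_nonneg t) 3]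
  · have h1 : ‖Complex.exp (Complex.I * t)‖ = 1 := by
      rw [mul_comm]; exact Complex.norm_exp_ofReal_mul_I t
    have h2 : ‖(t : ℂ) ^ 2 / 2‖ = |t| ^ 2 / 2 := by simp
    calc _ ≤ ‖Complex.exp (Complex.I * t)‖ + ‖(1 : ℂ)‖ + ‖Complex.I * (t : ℂ)‖
          + ‖(t : ℂ) ^ 2 / 2‖ := by
          refine (norm_add_le _ _).trans ?_
          gcongr
          refine (norm_sub_le _ _).trans ?_
          gcongr
          exact norm_sub_le _ _
      _ = 2 + |t| + |t| ^ 2 / 2 := by rw [h1, h2, hI, norm_one]; ring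
      _ ≤ 4 * |t| ^ 3 := by
        have h3 : 1 ≤ |t| ^ 2 := one_le_pow₀ ht
        nlinarith [mul_le_mul ht h3 zero_le_one (abs_nonneg t)]

/-- The Fourier series `∑ a k * exp (-k / x) * exp (i k θ)`. -/
noncomputable def expCharFun (a : ℕ → ℝ) (x θ : ℝ) : ℂ :=
  ∑' k : ℕ, ((a k * Real.exp (-k / x) : ℝ) : ℂ) * Complex.exp (Complex.I * ((k * θ : ℝ) : ℂ))

/-- The real decay exponent `∑ a k * exp (-k / x) * (1 - cos (k θ))`. -/
noncomputable def expDecay (a : ℕ → ℝ) (x θ : ℝ) : ℝ :=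
  ∑' k : ℕ, (1 - Real.cos (k * θ)) * (a k * Real.exp (-k / x))

namespace HasPowerScale

variable {a : ℕ → ℝ} {H : ℝ → ℝ}

theorem summable_zero (ha : HasPowerScale a H) {x : ℝ} (hx : 0 < x) :
    Summable fun k : ℕ => a k * Real.exp (-k / x) := by
  simpa using ha.summable 0 hx

theorem summable_decay (ha : HasPowerScale a H) {x : ℝ} (hx : 0 < x) (θ : ℝ) :
    Summable fun k : ℕ => (1 - Real.cos (k * θ)) * (a k * Real.exp (-k / x)) := by
  refine Summable.of_nonneg_of_le (fun k => ?_) (fun k => ?_) ((ha.summable_zero hx).mul_left 2)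
  · exact mul_nonneg (by linarith [Real.cos_le_one (k * θ)])
      (mul_nonneg (ha.nonneg k) (Real.exp_pos _).le)
  · exact mul_le_mul_of_nonneg_right (by linarith [Real.neg_one_le_cos (k * θ)])
      (mul_nonneg (ha.nonneg k) (Real.exp_pos _).le)

theorem summable_expCharFun (ha : HasPowerScale a H) {x : ℝ} (hx : 0 < x) (θ : ℝ) :
    Summable fun k : ℕ => ((a k * Real.exp (-k / x) : ℝ) : ℂ) *
      Complex.exp (Complex.I * ((k * θ : ℝ) : ℂ)) := by
  refine Summable.of_norm ((ha.summable_zero hx).congr fun k => ?_)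
  rw [norm_mul, mul_comm Complex.I, Complex.norm_exp_ofReal_mul_I, mul_one, Complex.norm_real,
    Real.norm_of_nonneg (mul_nonneg (ha.nonneg k) (Real.exp_pos _).le)]

theorem re_expCharFun (ha : HasPowerScale a H) {x : ℝ} (hx : 0 < x) (θ : ℝ) :
    (expCharFun a x θ).re = expMoment a 0 x - expDecay a x θ := by
  rw [expCharFun, Complex.re_tsum (ha.summable_expCharFun hx θ), expMoment, expDecay,
    ← (ha.summable 0 hx).tsum_sub (ha.summable_decay hx θ)]
  refine tsum_congr fun k => ?_
  rw [Complex.re_ofReal_mul, mul_comm Complex.I, Complex.exp_ofReal_mul_I_re]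
  ring

theorem norm_exp_expCharFun_sub (ha : HasPowerScale a H) {x : ℝ} (hx : 0 < x) (θ : ℝ) :
    ‖Complex.exp (expCharFun a x θ - expMoment a 0 x)‖ = Real.exp (-expDecay a x θ) := by
  rw [Complex.norm_exp, Complex.sub_re, ha.re_expCharFun hx, Complex.ofReal_re]
  congr 1; ring

theorem norm_expCharFun_sub_taylor_le (ha : HasPowerScale a H) {x : ℝ} (hx : 0 < x) (θ : ℝ) :
    ‖expCharFun a x θ - expMoment a 0 x - Complex.I * (expMoment a 1 x * θ : ℝ) +
      (expMoment a 2 x * θ ^ 2 / 2 : ℝ)‖ ≤ 4 * |θ| ^ 3 * expMoment a 3 x := by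
  have h0 := Complex.hasSum_ofReal.2 (ha.summable 0 hx).hasSum
  have h1 := (Complex.hasSum_ofReal.2 ((ha.summable 1 hx).hasSum.mul_right θ)).mul_left Complex.I
  have h2 := Complex.hasSum_ofReal.2 (((ha.summable 2 hx).hasSum.mul_right (θ ^ 2)).div_const 2)
  have h3 := (ha.summable 3 hx).hasSum.mul_left (4 * |θ| ^ 3)
  have hs := ((((ha.summable_expCharFun hx θ).hasSum.sub h0).sub h1).add h2)
  refine hs.norm_le_of_bounded h3 fun k => ?_
  have hw : 0 ≤ a k * Real.exp (-k / x) := mul_nonneg (ha.nonneg k) (Real.exp_pos _).le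
  have ht := Complex.norm_exp_I_mul_sub_taylor_le (k * θ)
  rw [abs_mul, Nat.abs_cast] at ht
  calc _ = ‖((a k * Real.exp (-k / x) : ℝ) : ℂ) * (Complex.exp (Complex.I * ((k * θ : ℝ) : ℂ)) - 1
          - Complex.I * ((k * θ : ℝ) : ℂ) + ((k * θ : ℝ) : ℂ) ^ 2 / 2)‖ := by
        congr 1; push_cast; ring
    _ = a k * Real.exp (-k / x) * ‖Complex.exp (Complex.I * ((k * θ : ℝ) : ℂ)) - 1
          - Complex.I * ((k * θ : ℝ) : ℂ) + ((k * θ : ℝ) : ℂ) ^ 2 / 2‖ := by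
        rw [norm_mul, Complex.norm_real, Real.norm_of_nonneg hw]
    _ ≤ a k * Real.exp (-k / x) * (4 * (k * |θ|) ^ 3) := by gcongr
    _ = _ := by ring

/-- On the block `x ≤ k ≤ 3 * x` one has `|k * θ| ≤ 3 < π`, where `1 - cos` is bounded below by a
multiple of the square. -/
theorem expDecay_lower_near (ha : HasPowerScale a H) :
    ∃ c : ℝ, 0 < c ∧ ∀ᶠ x : ℝ in atTop, ∀ θ : ℝ, |θ| ≤ 1 / x →
      c * (H x * x ^ 2) * θ ^ 2 ≤ expDecay a x θ := by
  obtain ⟨c, hc, h⟩ := ha.sum_block_lower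
  have hpi := Real.pi_pos
  refine ⟨c * (2 / Real.pi ^ 2), by positivity, ?_⟩
  filter_upwards [h, eventually_ge_atTop 2, ha.growth_tendsto.eventually_ge_atTop 0]
    with x hx hx1 hH θ hθ
  have hx0 : 0 < x := by linarith
  have h1 := hx (fun k => 1 - Real.cos (k * θ)) (fun k => by linarith [Real.cos_le_one (k * θ)])
    (ha.summable_decay hx0 θ) 2 (by norm_num)
  refine le_trans ?_ h1
  have h2 := Finset.card_nsmul_le_sum (Finset.Ico ⌈x⌉₊ (2 * ⌈x⌉₊))
    (fun k : ℕ => 1 - Real.cos (k * θ)) (2 / Real.pi ^ 2 * (x * θ) ^ 2) (fun k hk => by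
      rw [Finset.mem_Ico] at hk
      have h3 : x ≤ k := (Nat.le_ceil x).trans (by exact_mod_cast hk.1)
      have h4 : (k : ℝ) ≤ 3 * x := by
        have h3 : (k : ℝ) ≤ 2 * ⌈x⌉₊ := by exact_mod_cast hk.2.le
        have h4 := Nat.ceil_lt_add_one hx0.le
        linarith
      have h5 : |(k : ℝ) * θ| ≤ Real.pi := by
        rw [abs_mul, Nat.abs_cast]
        calc (k : ℝ) * |θ| ≤ 3 * x * (1 / x) := by gcongr
          _ = 3 := by field_simp
          _ ≤ Real.pi := Real.pi_gt_three.le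
      have h6 := Real.cos_le_one_sub_mul_cos_sq h5
      have h7 : (x * θ) ^ 2 ≤ (k * θ) ^ 2 := by
        rw [mul_pow, mul_pow]; gcongr
      have h8 : 2 / Real.pi ^ 2 * (x * θ) ^ 2 ≤ 2 / Real.pi ^ 2 * (k * θ) ^ 2 := by gcongr
      linarith)
  rw [Nat.card_Ico, nsmul_eq_mul, show 2 * ⌈x⌉₊ - ⌈x⌉₊ = ⌈x⌉₊ by omega] at h2
  calc c * (2 / Real.pi ^ 2) * (H x * x ^ 2) * θ ^ 2
      = c * H x / x * (x * (2 / Real.pi ^ 2 * (x * θ) ^ 2)) := by field_simp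
    _ ≤ c * H x / x * (⌈x⌉₊ * (2 / Real.pi ^ 2 * (x * θ) ^ 2)) := by
      gcongr; exact Nat.le_ceil x
    _ ≤ _ := by gcongr

/-- Over the block of `7 * ⌈x⌉₊` indices the cosines sum to at most `π / |θ| ≤ 4 * x`, so `1 - cos`
sums to at least `3 * x`. The factor 8 in the block length serves to beat this `4 * x`. -/
theorem expDecay_lower_far (ha : HasPowerScale a H) :
    ∃ c : ℝ, 0 < c ∧ ∀ᶠ x : ℝ in atTop, ∀ θ : ℝ, 1 / x ≤ |θ| → |θ| ≤ Real.pi →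
      c * H x ≤ expDecay a x θ := by
  obtain ⟨c, hc, h⟩ := ha.sum_block_lower
  refine ⟨3 * c, by positivity, ?_⟩
  filter_upwards [h, eventually_ge_atTop 2, ha.growth_tendsto.eventually_ge_atTop 0]
    with x hx hx1 hH θ hθ hθpi
  have hx0 : 0 < x := by linarith
  have h1 := hx (fun k => 1 - Real.cos (k * θ)) (fun k => by linarith [Real.cos_le_one (k * θ)])
    (ha.summable_decay hx0 θ) 8 le_rfl
  refine le_trans ?_ h1
  have hθ0 : 0 < |θ| := (by positivity : 0 < 1 / x).trans_le hθ
  have h2 := Real.abs_mul_sum_cos_le hθpi (show ⌈x⌉₊ ≤ 8 * ⌈x⌉₊ by omega)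
  have h3 : ∑ k ∈ Finset.Ico ⌈x⌉₊ (8 * ⌈x⌉₊), Real.cos (k * θ) ≤ 4 * x := by
    rw [mul_comm, ← le_div_iff₀ hθ0] at h2
    refine h2.trans ?_
    rw [div_le_iff₀ hθ0]
    rw [div_le_iff₀ hx0] at hθ
    nlinarith [Real.pi_le_four]
  rw [Finset.sum_sub_distrib, Finset.sum_const, Nat.card_Ico, nsmul_eq_mul,
    show 8 * ⌈x⌉₊ - ⌈x⌉₊ = 7 * ⌈x⌉₊ by omega]
  push_cast
  have h4 := Nat.le_ceil x
  calc 3 * c * H x = c * H x / x * (3 * x) := by field_simp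
    _ ≤ _ := by gcongr; linarith

/-- A single integrable majorant for the rescaled integrand on the whole circle. -/
theorem exp_neg_expDecay_le (ha : HasPowerScale a H) :
    ∃ K : ℝ, 0 < K ∧ ∀ᶠ x : ℝ in atTop, ∀ θ : ℝ, |θ| ≤ Real.pi →
      Real.exp (-expDecay a x θ) ≤ K * (1 + expMoment a 2 x * θ ^ 2)⁻¹ := by
  obtain ⟨c₁, hc₁, h₁⟩ := ha.expDecay_lower_near
  obtain ⟨c₂, hc₂, h₂⟩ := ha.expDecay_lower_far
  obtain ⟨K₂, hK₂, hu⟩ := ha.expMoment_upper 1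
  obtain ⟨β, hβ, hg⟩ := ha.growth
  have hpi := Real.pi_pos
  -- For the far range: `growth` gives `x ^ 2 ≤ H x ^ (2 / β)`, so the second moment times `θ ^ 2`
  -- is polynomial in `H x` and loses to `exp (c₂ * H x)`.
  have hdecay : ∀ᶠ y : ℝ in atTop,
      1 + K₂ * Real.pi ^ 2 * y ^ (1 + 2 / β) ≤ Real.exp (c₂ * y) := by
    have h1 := (isLittleO_rpow_exp_pos_mul_atTop (1 + 2 / β) hc₂).bound
      (show 0 < 1 / (2 * (K₂ * Real.pi ^ 2)) by positivity)
    have h2 : ∀ᶠ y : ℝ in atTop, 2 ≤ Real.exp (c₂ * y) :=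
      (Real.tendsto_exp_atTop.comp (tendsto_id.const_mul_atTop hc₂)).eventually_ge_atTop 2
    filter_upwards [h1, h2, eventually_ge_atTop 0] with y hy hy2 hy0
    rw [Real.norm_of_nonneg (by positivity), Real.norm_of_nonneg (by positivity),
      div_mul_eq_mul_div, one_mul, le_div_iff₀ (by positivity)] at hy
    linarith
  refine ⟨K₂ / c₁ + 1, by positivity, ?_⟩
  filter_upwards [h₁, h₂, hu, hg, ha.growth_tendsto.eventually hdecay,
    ha.growth_tendsto.eventually_ge_atTop 0, eventually_ge_atTop 1]
    with x hx₁ hx₂ hxu hxg hxd hH hx1 θ hθ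
  have hx0 : 0 < x := by linarith
  have hS : 0 ≤ expMoment a 2 x * θ ^ 2 := mul_nonneg (ha.expMoment_nonneg 2 x) (sq_nonneg θ)
  rw [Real.exp_neg, ← div_eq_mul_inv, le_div_iff₀ (by positivity), inv_mul_le_iff₀ (Real.exp_pos _)]
  have hxu' : expMoment a 2 x ≤ K₂ * (H x * x ^ 2) := hxu
  rcases le_total |θ| (1 / x) with h | h
  -- Near range: the second moment times `θ ^ 2` is at most a constant times the decay exponent `D`,
  -- and `1 + D ≤ exp D`.
  · have h3 := hx₁ θ h
    have h4 := Real.add_one_le_exp (expDecay a x θ)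
    have h5 : expMoment a 2 x * θ ^ 2 ≤ K₂ / c₁ * expDecay a x θ := by
      calc _ ≤ K₂ * (H x * x ^ 2) * θ ^ 2 := by gcongr
        _ = K₂ / c₁ * (c₁ * (H x * x ^ 2) * θ ^ 2) := by field_simp
        _ ≤ _ := by gcongr
    have h6 : 0 ≤ expDecay a x θ := le_trans (by positivity) h3
    have h7 : 0 ≤ K₂ / c₁ := by positivity
    nlinarith
  · have h3 := hx₂ θ h hθ
    have h4 : x ^ 2 ≤ H x ^ (2 / β) := by
      calc x ^ 2 = (x ^ β) ^ (2 / β) := by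
            rw [← Real.rpow_mul hx0.le, mul_div_cancel₀ _ hβ.ne', Real.rpow_two]
        _ ≤ _ := by gcongr
    have hH0 : 0 < H x := (by positivity : 0 < x ^ β).trans_le hxg
    have h5 : expMoment a 2 x * θ ^ 2 ≤ K₂ * Real.pi ^ 2 * H x ^ (1 + 2 / β) := by
      have : θ ^ 2 ≤ Real.pi ^ 2 := by rw [← sq_abs]; gcongr
      calc _ ≤ K₂ * (H x * x ^ 2) * Real.pi ^ 2 := by gcongr
        _ ≤ K₂ * (H x * H x ^ (2 / β)) * Real.pi ^ 2 := by gcongr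
        _ = _ := by rw [Real.rpow_add hH0, Real.rpow_one]; ring
    have h6 : Real.exp (c₂ * H x) ≤ Real.exp (expDecay a x θ) := Real.exp_le_exp.2 h3
    have h7 : 0 ≤ K₂ / c₁ := by positivity
    calc _ ≤ Real.exp (expDecay a x θ) * 1 := by linarith
      _ ≤ _ := by gcongr; linarith

end HasPowerScale

/-! ### Laplace's method for the rescaled integral. -/

namespace HasPowerScale

variable {a : ℕ → ℝ} {H : ℝ → ℝ}

theorem continuous_expCharFun (ha : HasPowerScale a H) {x : ℝ} (hx : 0 < x) :
    Continuous (expCharFun a x) := by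
  refine continuous_tsum (fun k => by fun_prop) (ha.summable_zero hx) fun k θ => ?_
  rw [norm_mul, mul_comm Complex.I, Complex.norm_exp_ofReal_mul_I, mul_one, Complex.norm_real,
    Real.norm_of_nonneg (mul_nonneg (ha.nonneg k) (Real.exp_pos _).le)]

theorem tendsto_expMoment (ha : HasPowerScale a H) (m : ℕ) :
    Tendsto (expMoment a m) atTop atTop := by
  obtain ⟨c, hc, h⟩ := ha.expMoment_lower m
  refine tendsto_atTop_mono' _ ?_ (ha.growth_tendsto.const_mul_atTop hc)
  filter_upwards [h, eventually_ge_atTop 1, ha.growth_tendsto.eventually_ge_atTop 0]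
    with x hx hx1 hH
  refine le_trans ?_ hx
  gcongr
  exact le_mul_of_one_le_right hH (one_le_pow₀ hx1)

theorem tendsto_expMoment_one_div_two (ha : HasPowerScale a H) :
    Tendsto (fun x => expMoment a 1 x / expMoment a 2 x) atTop (𝓝 0) := by
  obtain ⟨c, hc, h2⟩ := ha.expMoment_lower 2
  obtain ⟨K, hK, h1⟩ := ha.expMoment_upper 0
  have hlim : Tendsto (fun x : ℝ => K / c * x⁻¹) atTop (𝓝 0) := by
    simpa using tendsto_inv_atTop_zero.const_mul (K / c)
  refine squeeze_zero' (Eventually.of_forall fun x =>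
    div_nonneg (ha.expMoment_nonneg 1 x) (ha.expMoment_nonneg 2 x)) ?_ hlim
  filter_upwards [h1, h2, eventually_ge_atTop 1, ha.growth_tendsto.eventually_gt_atTop 0]
    with x hx1 hx2 hx hH
  have hx0 : 0 < x := by linarith
  calc _ ≤ K * (H x * x ^ (0 + 1)) / (c * (H x * x ^ 2)) :=
        div_le_div₀ (by positivity) hx1 (by positivity) hx2
    _ = K / c * x⁻¹ := by rw [zero_add, pow_one]; field_simp

/-- This is the cubic Taylor error after rescaling; the powers of `x` cancel and `H x ^ (-1/2)`
remains. -/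
theorem tendsto_expMoment_three_div (ha : HasPowerScale a H) :
    Tendsto (fun x => expMoment a 3 x / Real.sqrt (expMoment a 2 x) ^ 3) atTop (𝓝 0) := by
  obtain ⟨c, hc, h2⟩ := ha.expMoment_lower 2
  obtain ⟨K, hK, h3⟩ := ha.expMoment_upper 2
  have hlim : Tendsto (fun x : ℝ => K / c * (Real.sqrt (c * H x))⁻¹) atTop (𝓝 0) := by
    have := ((Real.tendsto_sqrt_atTop.comp
      (ha.growth_tendsto.const_mul_atTop hc)).inv_tendsto_atTop).const_mul (K / c)
    simpa using this
  refine squeeze_zero' (Eventually.of_forall fun x =>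
    div_nonneg (ha.expMoment_nonneg 3 x) (by positivity)) ?_ hlim
  filter_upwards [h2, h3, eventually_ge_atTop 1, ha.growth_tendsto.eventually_gt_atTop 0]
    with x hx2 hx3 hx hH
  have hx0 : 0 < x := by linarith
  have hs : Real.sqrt (c * H x) * x ≤ Real.sqrt (expMoment a 2 x) := by
    refine Real.le_sqrt_of_sq_le ?_
    rw [mul_pow, Real.sq_sqrt (by positivity)]
    linarith
  have hs0 : 0 < Real.sqrt (c * H x) := by positivity
  calc _ ≤ K * (H x * x ^ (2 + 1)) / (Real.sqrt (c * H x) * x) ^ 3 :=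
        div_le_div₀ (by positivity) hx3 (by positivity) (by gcongr)
    _ = K * H x / (Real.sqrt (c * H x) ^ 2 * Real.sqrt (c * H x)) := by field_simp
    _ = K / c * (Real.sqrt (c * H x))⁻¹ := by
      rw [Real.sq_sqrt (by positivity)]; field_simp

theorem tendsto_exp_rescaled (ha : HasPowerScale a H) (t : ℝ) :
    Tendsto (fun x => Complex.exp (expCharFun a x (t / Real.sqrt (expMoment a 2 x)) -
      expMoment a 0 x - Complex.I * (expMoment a 1 x * (t / Real.sqrt (expMoment a 2 x)) : ℝ)))
      atTop (𝓝 (Complex.exp ((-(t ^ 2 / 2) : ℝ) : ℂ))) := by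
  refine (Complex.continuous_exp.tendsto _).comp ?_
  rw [tendsto_iff_norm_sub_tendsto_zero]
  have hlim : Tendsto (fun x => 4 * |t| ^ 3 *
      (expMoment a 3 x / Real.sqrt (expMoment a 2 x) ^ 3)) atTop (𝓝 0) := by
    simpa using ha.tendsto_expMoment_three_div.const_mul (4 * |t| ^ 3)
  refine squeeze_zero' (Eventually.of_forall fun x => norm_nonneg _) ?_ hlim
  filter_upwards [eventually_gt_atTop 0, (ha.tendsto_expMoment 2).eventually_gt_atTop 0]
    with x hx hS
  have h := ha.norm_expCharFun_sub_taylor_le hx (t / Real.sqrt (expMoment a 2 x))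
  have h1 : expMoment a 2 x * (t / Real.sqrt (expMoment a 2 x)) ^ 2 / 2 = t ^ 2 / 2 := by
    rw [div_pow, Real.sq_sqrt hS.le]; field_simp
  rw [h1, abs_div, abs_of_nonneg (Real.sqrt_nonneg _)] at h
  rw [Complex.ofReal_neg, sub_neg_eq_add]
  exact h.trans (le_of_eq (by rw [div_pow]; ring))

/-- Laplace's method on the circle. -/
theorem tendsto_integral (ha : HasPowerScale a H) {ρ : ℝ} (hρ : 0 < ρ) {φ : ℂ → ℂ}
    (hφ : ContinuousOn φ (Metric.closedBall 0 ρ)) :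
    Tendsto (fun x : ℝ => (Real.sqrt (expMoment a 2 x) : ℂ) * ∫ θ in (-Real.pi)..Real.pi,
      Complex.exp (expCharFun a x θ - expMoment a 0 x - Complex.I * (expMoment a 1 x * θ : ℝ)) *
        φ ((ρ * Real.exp (-1 / x) : ℝ) * Complex.exp (θ * Complex.I))) atTop
      (𝓝 (Real.sqrt (2 * Real.pi) * φ ρ)) := by
  obtain ⟨K, hK, hmaj⟩ := ha.exp_neg_expDecay_le
  obtain ⟨M, hM⟩ := (isCompact_closedBall (0 : ℂ) ρ).exists_bound_of_continuousOn hφ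
  set P : ℝ → ℝ → ℂ := fun x θ => (ρ * Real.exp (-1 / x) : ℝ) * Complex.exp (θ * Complex.I)
    with hP
  set g : ℝ → ℝ → ℂ := fun x θ => Complex.exp (expCharFun a x θ - expMoment a 0 x -
    Complex.I * (expMoment a 1 x * θ : ℝ)) * φ (P x θ) with hg
  have hPmem : ∀ x : ℝ, 0 < x → ∀ θ, P x θ ∈ Metric.closedBall (0 : ℂ) ρ := by
    intro x hx θ
    rw [mem_closedBall_zero_iff, hP, norm_mul, Complex.norm_exp_ofReal_mul_I, mul_one,
      Complex.norm_real, Real.norm_of_nonneg (by positivity)]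
    refine mul_le_of_le_one_right hρ.le (Real.exp_le_one_iff.2 ?_)
    rw [neg_div]; exact neg_nonpos_of_nonneg (by positivity)
  have hgcont : ∀ x : ℝ, 0 < x → Continuous (g x) := by
    intro x hx
    have h1 := ha.continuous_expCharFun hx
    have h2 : Continuous fun θ => φ (P x θ) :=
      hφ.comp_continuous (by fun_prop) (hPmem x hx)
    refine Continuous.mul ?_ h2
    fun_prop
  set s : ℝ → ℝ := fun x => Real.sqrt (expMoment a 2 x) with hs
  have hsInf : Tendsto s atTop atTop := Real.tendsto_sqrt_atTop.comp (ha.tendsto_expMoment 2)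
  -- The substitution `θ = t / s x` turns the circle into this growing interval; the indicator moves
  -- all integrals to the full line.
  let J : ℝ → Set ℝ := fun x => Set.Ioc (-Real.pi * s x) (Real.pi * s x)
  have hsub : ∀ᶠ x in atTop, ∫ t, (J x).indicator (fun t => g x (t / s x)) t =
      (s x : ℂ) * ∫ θ in (-Real.pi)..Real.pi, g x θ := by
    filter_upwards [hsInf.eventually_gt_atTop 0] with x hx
    rw [MeasureTheory.integral_indicator measurableSet_Ioc,
      ← intervalIntegral.integral_of_le (by nlinarith [Real.pi_pos]),
      intervalIntegral.integral_comp_div _ hx.ne', mul_div_cancel_right₀ _ hx.ne',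
      mul_div_cancel_right₀ _ hx.ne', Complex.real_smul]
  refine Tendsto.congr' hsub ?_
  have hval : (Real.sqrt (2 * Real.pi) * φ ρ : ℂ) =
      ∫ t : ℝ, Complex.exp ((-(t ^ 2 / 2) : ℝ) : ℂ) * φ ρ := by
    rw [MeasureTheory.integral_mul_const]
    congr 1
    simp_rw [← Complex.ofReal_exp]
    rw [integral_complex_ofReal]
    have := integral_gaussian (1 / 2)
    rw [show Real.pi / (1 / 2) = 2 * Real.pi by ring] at this
    rw [← this]
    congr 1
    refine MeasureTheory.integral_congr_ae (Eventually.of_forall fun t => ?_)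
    simp only
    congr 1; ring
  rw [hval]
  refine MeasureTheory.tendsto_integral_filter_of_dominated_convergence
    (fun t => K * M * (1 + t ^ 2)⁻¹) ?_ ?_ (integrable_inv_one_add_sq.const_mul _) ?_
  · filter_upwards [eventually_gt_atTop 0] with x hx
    have := hgcont x hx
    exact (Continuous.aestronglyMeasurable (by fun_prop)).indicator measurableSet_Ioc
  · filter_upwards [eventually_gt_atTop 0, hmaj, hsInf.eventually_gt_atTop 0] with x hx hx2 hsx
    refine Eventually.of_forall fun t => ?_
    have hM0 : 0 ≤ M := (norm_nonneg _).trans (hM _ (hPmem x hx 0))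
    by_cases ht : t ∈ J x
    · rw [Set.indicator_of_mem ht]
      have h1 : |t / s x| ≤ Real.pi := by
        rw [abs_div, abs_of_pos hsx, div_le_iff₀ hsx, abs_le]
        exact ⟨by linarith [ht.1], ht.2⟩
      have h2 := hx2 _ h1
      have h3 : expMoment a 2 x * (t / s x) ^ 2 = t ^ 2 := by
        have : s x ^ 2 = expMoment a 2 x := Real.sq_sqrt (ha.expMoment_nonneg 2 x)
        rw [← this]; field_simp
      rw [h3] at h2
      have h4 : ‖Complex.exp (expCharFun a x (t / s x) - expMoment a 0 x -
          Complex.I * (expMoment a 1 x * (t / s x) : ℝ))‖ ≤ K * (1 + t ^ 2)⁻¹ := by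
        rw [Complex.exp_sub, norm_div, ha.norm_exp_expCharFun_sub hx, mul_comm Complex.I,
          Complex.norm_exp_ofReal_mul_I, div_one]
        exact h2
      simp only [hg]
      rw [norm_mul]
      calc _ ≤ K * (1 + t ^ 2)⁻¹ * M := by
            gcongr
            exact hM _ (hPmem x hx _)
        _ = _ := by ring
    · rw [Set.indicator_of_notMem ht, norm_zero]; positivity
  · refine Eventually.of_forall fun t => ?_
    have hdiv : Tendsto (fun x => t / s x) atTop (𝓝 0) := hsInf.const_div_atTop t
    have hPlim : Tendsto (fun x => P x (t / s x)) atTop (𝓝 (ρ : ℂ)) := by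
      have h1 : Tendsto (fun x : ℝ => ρ * Real.exp (-1 / x)) atTop (𝓝 ρ) := by
        have := (Real.continuous_exp.tendsto 0).comp
          ((tendsto_id (α := ℝ) (x := atTop)).const_div_atTop (-1))
        simpa using this.const_mul ρ
      have h2 : Tendsto (fun x => Complex.exp (((t / s x : ℝ) : ℂ) * Complex.I)) atTop (𝓝 1) := by
        have hc : Continuous fun y : ℝ => Complex.exp ((y : ℂ) * Complex.I) := by fun_prop
        have := (hc.tendsto 0).comp hdiv
        simpa [Function.comp_def] using this
      have := ((Complex.continuous_ofReal.tendsto ρ).comp h1).mul h2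
      simpa [hP, Function.comp_def] using this
    have hφlim : Tendsto (fun x => φ (P x (t / s x))) atTop (𝓝 (φ ρ)) := by
      have hρmem : (ρ : ℂ) ∈ Metric.closedBall (0 : ℂ) ρ := by
        simp [abs_of_pos hρ]
      refine (hφ _ hρmem).tendsto.comp (tendsto_nhdsWithin_iff.2 ⟨hPlim, ?_⟩)
      filter_upwards [eventually_gt_atTop 0] with x hx using hPmem x hx _
    refine ((ha.tendsto_exp_rescaled t).mul hφlim).congr' ?_
    have hJ : ∀ᶠ x in atTop, t ∈ J x := by
      filter_upwards [hsInf.eventually_gt_atTop |t|] with x hx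
      have h1 := abs_lt.1 hx
      have h2 := Real.pi_gt_three
      have h3 := abs_nonneg t
      constructor <;> nlinarith [h1.1, h1.2]
    filter_upwards [hJ] with x hx
    rw [Set.indicator_of_mem hx]

end HasPowerScale

/-! ### From formal power series to functions: powers, the exponential, Cauchy's formula. -/

theorem PowerSeries.coeff_pow_nonneg {p : PowerSeries ℝ} (hp : ∀ n, 0 ≤ PowerSeries.coeff n p)
    (d n : ℕ) : 0 ≤ PowerSeries.coeff n (p ^ d) := by
  induction d generalizing n with
  | zero => rw [pow_zero, PowerSeries.coeff_one]; split_ifs <;> norm_num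
  | succ d ih =>
    rw [pow_succ, PowerSeries.coeff_mul]
    exact Finset.sum_nonneg fun x _ => mul_nonneg (ih _) (hp _)

section Evaluation

variable {𝕜 : Type*} [NormedField 𝕜] [NormedAlgebra ℝ 𝕜]

theorem norm_smul_pow_of_nonneg {r : ℝ} (hr : 0 ≤ r) (w : 𝕜) (n : ℕ) :
    ‖r • w ^ n‖ = r * ‖w‖ ^ n := by
  rw [norm_smul, norm_pow, Real.norm_of_nonneg hr]

/-- Induction by Cauchy products; absolute summability is carried along because each product needs
it. -/
theorem PowerSeries.hasSum_coeff_pow_smul [CompleteSpace 𝕜] {p : PowerSeries ℝ}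
    (hp : ∀ n, 0 ≤ PowerSeries.coeff n p) {w : 𝕜}
    (hw : Summable fun n => PowerSeries.coeff n p * ‖w‖ ^ n) (d : ℕ) :
    (Summable fun n => PowerSeries.coeff n (p ^ d) * ‖w‖ ^ n) ∧
      HasSum (fun n => PowerSeries.coeff n (p ^ d) • w ^ n)
        ((∑' n, PowerSeries.coeff n p • w ^ n) ^ d) := by
  have hp' : Summable fun n => ‖PowerSeries.coeff n p • w ^ n‖ :=
    hw.congr fun n => (norm_smul_pow_of_nonneg (hp n) w n).symm
  induction d with
  | zero =>
    have h1 : HasSum (fun n => PowerSeries.coeff n (1 : PowerSeries ℝ) • w ^ n) 1 := by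
      convert! hasSum_single (f := fun n => PowerSeries.coeff n (1 : PowerSeries ℝ) • w ^ n) 0 ?_
      · simp
      · intro n hn; simp [PowerSeries.coeff_one, hn]
    refine ⟨?_, by simpa using h1⟩
    refine summable_of_ne_finset_zero (s := {0}) fun n hn => ?_
    rw [Finset.mem_singleton] at hn
    simp [PowerSeries.coeff_one, hn]
  | succ d ih =>
    obtain ⟨ih1, ih2⟩ := ih
    have ih' : Summable fun n => ‖PowerSeries.coeff n (p ^ d) • w ^ n‖ :=
      ih1.congr fun n => (norm_smul_pow_of_nonneg (PowerSeries.coeff_pow_nonneg hp d n) w n).symm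
    have hconv : ∀ n, ∑ kl ∈ Finset.HasAntidiagonal.antidiagonal n, (PowerSeries.coeff kl.1 (p ^ d) • w ^ kl.1) *
        (PowerSeries.coeff kl.2 p • w ^ kl.2) = PowerSeries.coeff n (p ^ (d + 1)) • w ^ n := by
      intro n
      rw [pow_succ, PowerSeries.coeff_mul, Finset.sum_smul]
      refine Finset.sum_congr rfl fun kl hkl => ?_
      rw [smul_mul_smul_comm, ← pow_add, Finset.HasAntidiagonal.mem_antidiagonal.1 hkl]
    have hs := summable_norm_sum_mul_antidiagonal_of_summable_norm ih' hp'
    have ht := tsum_mul_tsum_eq_tsum_sum_antidiagonal_of_summable_norm ih' hp'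
    simp_rw [hconv] at hs ht
    refine ⟨hs.congr fun n =>
      norm_smul_pow_of_nonneg (PowerSeries.coeff_pow_nonneg hp _ n) w n, ?_⟩
    rw [pow_succ (∑' n, PowerSeries.coeff n p • w ^ n), ← ih2.tsum_eq, ht]
    exact hs.of_norm.hasSum

end Evaluation

theorem HasSum.swap_of_summable {ι κ E : Type*} [NormedAddCommGroup E] [CompleteSpace E]
    {f : ι × κ → E} (hf : Summable f) {g : ι → E} {h : κ → E}
    (hg : ∀ i, HasSum (fun k => f (i, k)) (g i)) (hh : ∀ k, HasSum (fun i => f (i, k)) (h k)) :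
    HasSum h (∑' i, g i) := by
  have h1 := (hf.hasSum.prod_fiberwise hg).tsum_eq
  have h2 := ((Equiv.prodComm κ ι).hasSum_iff.2 hf.hasSum).prod_fiberwise
    (g := h) (fun k => by simpa using hh k)
  rwa [h1]

theorem PowerSeries.coeff_pow_eq_zero_of_lt {p : PowerSeries ℝ}
    (hp : PowerSeries.constantCoeff p = 0) {n d : ℕ} (h : n < d) :
    PowerSeries.coeff n (p ^ d) = 0 := by
  obtain ⟨q, rfl⟩ := PowerSeries.X_dvd_iff.2 hp
  rw [mul_pow, PowerSeries.coeff_X_pow_mul', if_neg (by omega)]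

/-- `p ^ d` has order at least `d`, so only `d ≤ n` contributes. The `HasSum` form prepares the
exchange of summations. -/
theorem PowerSeries.hasSum_coeff_exp_subst {p : PowerSeries ℝ}
    (hp0 : PowerSeries.constantCoeff p = 0) (n : ℕ) :
    HasSum (fun d : ℕ => ((d.factorial : ℝ))⁻¹ * PowerSeries.coeff n (p ^ d))
      (PowerSeries.coeff n ((PowerSeries.exp ℝ).subst p)) := by
  rw [PowerSeries.coeff_subst' (PowerSeries.HasSubst.of_constantCoeff_zero' hp0)]
  have hz : ∀ d ∉ Finset.range (n + 1),
      PowerSeries.coeff d (PowerSeries.exp ℝ) • PowerSeries.coeff n (p ^ d) = 0 := by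
    intro d hd
    rw [PowerSeries.coeff_pow_eq_zero_of_lt hp0 (by simpa using hd), smul_zero]
  rw [finsum_eq_sum_of_support_subset (s := Finset.range (n + 1)) _ (fun d hd => by
    by_contra h
    exact hd (hz d (by simpa using h)))]
  have hterm : ∀ d : ℕ, PowerSeries.coeff d (PowerSeries.exp ℝ) • PowerSeries.coeff n (p ^ d) =
      ((d.factorial : ℝ))⁻¹ * PowerSeries.coeff n (p ^ d) := by
    intro d
    rw [PowerSeries.coeff_exp, smul_eq_mul]
    simp
  simpa only [hterm] using hasSum_sum_of_ne_finset_zero hz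

/-- Evaluation of `exp ∘ p` for a power series `p` with nonnegative coefficients. -/
theorem PowerSeries.summable_and_hasSum_exp_subst {p : PowerSeries ℝ}
    (hp : ∀ n, 0 ≤ PowerSeries.coeff n p) (hp0 : PowerSeries.constantCoeff p = 0) {w : ℂ}
    (hw : Summable fun n => PowerSeries.coeff n p * ‖w‖ ^ n) :
    (Summable fun n => PowerSeries.coeff n ((PowerSeries.exp ℝ).subst p) * ‖w‖ ^ n) ∧
      HasSum (fun n => PowerSeries.coeff n ((PowerSeries.exp ℝ).subst p) • w ^ n)
        (Complex.exp (∑' n, PowerSeries.coeff n p • w ^ n)) := by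
  have hwr : Summable fun n => PowerSeries.coeff n p * ‖(‖w‖ : ℝ)‖ ^ n := by simpa using hw
  have hnn : ∀ d n : ℕ, 0 ≤ ((d.factorial : ℝ))⁻¹ * PowerSeries.coeff n (p ^ d) := fun d n =>
    mul_nonneg (by positivity) (PowerSeries.coeff_pow_nonneg hp d n)
  have hreal : ∀ d : ℕ, HasSum
      (fun n => ((d.factorial : ℝ))⁻¹ * PowerSeries.coeff n (p ^ d) * ‖w‖ ^ n)
      (((d.factorial : ℝ))⁻¹ * (∑' n, PowerSeries.coeff n p * ‖w‖ ^ n) ^ d) := by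
    intro d
    simpa [mul_assoc] using
      (PowerSeries.hasSum_coeff_pow_smul hp hwr d).2.mul_left ((d.factorial : ℝ))⁻¹
  have hcomplex : ∀ d : ℕ, HasSum
      (fun n => (((d.factorial : ℝ))⁻¹ * PowerSeries.coeff n (p ^ d)) • w ^ n)
      (((d.factorial : ℝ))⁻¹ • (∑' n, PowerSeries.coeff n p • w ^ n) ^ d) := by
    intro d
    simpa only [mul_smul] using
      (PowerSeries.hasSum_coeff_pow_smul hp hw d).2.const_smul ((d.factorial : ℝ))⁻¹
  -- Nonnegativity reduces absolute summability of the double series to the iterated sum at `‖w‖`,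
  -- which is a real exponential series.
  have hsumr : Summable fun x : ℕ × ℕ =>
      ((x.1.factorial : ℝ))⁻¹ * PowerSeries.coeff x.2 (p ^ x.1) * ‖w‖ ^ x.2 := by
    refine (summable_prod_of_nonneg fun x => mul_nonneg (hnn _ _) (by positivity)).2
      ⟨fun d => (hreal d).summable, ?_⟩
    simp only [(hreal _).tsum_eq]
    refine (Real.summable_pow_div_factorial (∑' n, PowerSeries.coeff n p * ‖w‖ ^ n)).congr
      fun d => by rw [div_eq_inv_mul]
  have hsumc : Summable fun x : ℕ × ℕ =>
      (((x.1.factorial : ℝ))⁻¹ * PowerSeries.coeff x.2 (p ^ x.1)) • w ^ x.2 :=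
    Summable.of_norm (hsumr.congr fun x => (norm_smul_pow_of_nonneg (hnn _ _) w _).symm)
  constructor
  · exact (HasSum.swap_of_summable hsumr hreal fun n =>
      (PowerSeries.hasSum_coeff_exp_subst hp0 n).mul_right (‖w‖ ^ n)).summable
  · have h := HasSum.swap_of_summable hsumc hcomplex fun n =>
      (PowerSeries.hasSum_coeff_exp_subst hp0 n).smul_const (w ^ n)
    convert! h using 1
    rw [Complex.exp_eq_exp_ℂ, NormedSpace.exp_eq_tsum ℝ]

theorem Complex.integral_exp_int_mul_I (m : ℤ) :
    ∫ θ in (-Real.pi)..Real.pi, Complex.exp ((m : ℂ) * Complex.I * θ) =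
      if m = 0 then 2 * (Real.pi : ℂ) else 0 := by
  split_ifs with h
  · subst h
    simp
    ring
  · have hc : (m : ℂ) * Complex.I ≠ 0 := mul_ne_zero (by exact_mod_cast h) Complex.I_ne_zero
    rw [integral_exp_mul_complex hc]
    have : Complex.exp ((m : ℂ) * Complex.I * Real.pi) =
        Complex.exp ((m : ℂ) * Complex.I * (-Real.pi : ℝ)) := by
      rw [Complex.exp_eq_exp_iff_exists_int]
      exact ⟨m, by push_cast; ring⟩
    rw [this, sub_self, zero_div]

/-- Cauchy's coefficient formula for an absolutely convergent power series on a circle. -/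
theorem integral_eq_coeff_of_summable {g : ℕ → ℝ} (hg : ∀ n, 0 ≤ g n) {r : ℝ} (hr : 0 < r)
    (hsum : Summable fun n => g n * r ^ n) {F : ℝ → ℂ}
    (hF : ∀ θ : ℝ, HasSum (fun n => g n • ((r : ℂ) * Complex.exp (θ * Complex.I)) ^ n) (F θ))
    (n : ℕ) :
    ∫ θ in (-Real.pi)..Real.pi, F θ * Complex.exp (-(n * θ * Complex.I)) =
      2 * Real.pi * (g n * r ^ n : ℝ) := by
  have hterm : ∀ (k : ℕ) (θ : ℝ), g k • ((r : ℂ) * Complex.exp (θ * Complex.I)) ^ k *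
      Complex.exp (-(n * θ * Complex.I)) =
      (g k * r ^ k : ℝ) * Complex.exp ((((k : ℤ) - n : ℤ) : ℂ) * Complex.I * θ) := by
    intro k θ
    have h : (((k : ℤ) - n : ℤ) : ℂ) * Complex.I * θ =
        k * (θ * Complex.I) + -(n * θ * Complex.I) := by push_cast; ring
    rw [h, Complex.exp_add, mul_pow, ← Complex.exp_nat_mul, Complex.real_smul]
    push_cast
    ring
  have h := intervalIntegral.hasSum_integral_of_dominated_convergence (μ := MeasureTheory.volume)
    (a := -Real.pi) (b := Real.pi)
    (F := fun (k : ℕ) (θ : ℝ) => (g k * r ^ k : ℝ) *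
      Complex.exp ((((k : ℤ) - n : ℤ) : ℂ) * Complex.I * θ))
    (f := fun θ => F θ * Complex.exp (-(n * θ * Complex.I)))
    (fun k _ => g k * r ^ k)
    (fun k => Continuous.aestronglyMeasurable (by fun_prop))
    (fun k => Eventually.of_forall fun θ _ => by
      rw [norm_mul, Complex.norm_real, Real.norm_of_nonneg (mul_nonneg (hg k) (by positivity)),
        show (((k : ℤ) - n : ℤ) : ℂ) * Complex.I * θ =
          (((((k : ℤ) - n : ℤ) : ℝ) * θ : ℝ) : ℂ) * Complex.I by push_cast; ring,
        Complex.norm_exp_ofReal_mul_I, mul_one])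
    (Eventually.of_forall fun θ _ => hsum)
    intervalIntegrable_const
    (Eventually.of_forall fun θ _ => by
      have := (hF θ).mul_right (Complex.exp (-(n * θ * Complex.I)))
      simpa only [hterm] using this)
  rw [← h.tsum_eq, tsum_eq_single n]
  · rw [intervalIntegral.integral_const_mul, Complex.integral_exp_int_mul_I, if_pos (sub_self _)]
    ring
  · intro k hk
    rw [intervalIntegral.integral_const_mul, Complex.integral_exp_int_mul_I, if_neg, mul_zero]
    rw [sub_eq_zero]
    exact_mod_cast hk

/-! ### Evaluation of the multiset series and of its tail `j ≥ 2`. -/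

/-- The sum of a real power series at a point of a normed `ℝ`-algebra. -/
noncomputable def PowerSeries.evalSum {𝕜 : Type*} [NormedField 𝕜] [NormedAlgebra ℝ 𝕜]
    (p : PowerSeries ℝ) (w : 𝕜) : 𝕜 :=
  ∑' k : ℕ, PowerSeries.coeff k p • w ^ k

section EvalSum

variable {𝕜 : Type*} [NormedField 𝕜] [NormedAlgebra ℝ 𝕜] {p : PowerSeries ℝ}

theorem PowerSeries.summable_smul_pow_of_norm_le [CompleteSpace 𝕜]
    (hp : ∀ n, 0 ≤ PowerSeries.coeff n p) {r : ℝ}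
    (hr : Summable fun n => PowerSeries.coeff n p * r ^ n) {w : 𝕜} (hw : ‖w‖ ≤ r) :
    Summable fun n => PowerSeries.coeff n p • w ^ n := by
  refine Summable.of_norm_bounded hr fun n => ?_
  rw [norm_smul_pow_of_nonneg (hp n)]
  have := hp n
  gcongr

theorem PowerSeries.norm_evalSum_le (hp : ∀ n, 0 ≤ PowerSeries.coeff n p) {r : ℝ}
    (hr : Summable fun n => PowerSeries.coeff n p * r ^ n) {w : 𝕜} (hw : ‖w‖ ≤ r) :
    ‖p.evalSum w‖ ≤ p.evalSum r := by
  refine tsum_of_norm_bounded (by simpa [PowerSeries.evalSum] using hr.hasSum) fun n => ?_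
  rw [norm_smul_pow_of_nonneg (hp n)]
  have := hp n
  gcongr

theorem PowerSeries.continuousOn_evalSum [CompleteSpace 𝕜]
    (hp : ∀ n, 0 ≤ PowerSeries.coeff n p) {r : ℝ}
    (hr : Summable fun n => PowerSeries.coeff n p * r ^ n) :
    ContinuousOn (p.evalSum : 𝕜 → 𝕜) (Metric.closedBall 0 r) := by
  refine continuousOn_tsum (fun n => by fun_prop) hr fun n w hw => ?_
  rw [norm_smul_pow_of_nonneg (hp n)]
  have := hp n
  have hw' : ‖w‖ ≤ r := by simpa using hw
  gcongr

theorem PowerSeries.evalSum_ofReal (x : ℝ) : p.evalSum (x : ℂ) = (p.evalSum x : ℝ) := by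
  rw [PowerSeries.evalSum, PowerSeries.evalSum, Complex.ofReal_tsum]
  simp

/-- Without constant term, `p (r ^ (i + 1)) ≤ r ^ i * p r`. -/
theorem PowerSeries.evalSum_pow_mul_le (hp : ∀ n, 0 ≤ PowerSeries.coeff n p)
    (hp0 : PowerSeries.coeff 0 p = 0) {r s : ℝ} (hr0 : 0 ≤ r) (hs0 : 0 ≤ s) (hr1 : r ≤ 1)
    (hs : Summable fun n => PowerSeries.coeff n p * s ^ n) (i : ℕ) :
    p.evalSum (r ^ i * s) ≤ r ^ i * p.evalSum s := by
  rw [PowerSeries.evalSum, PowerSeries.evalSum, ← tsum_mul_left]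
  have hle : ∀ k, PowerSeries.coeff k p • (r ^ i * s) ^ k ≤
      r ^ i * (PowerSeries.coeff k p • s ^ k) := by
    intro k
    simp only [smul_eq_mul]
    rcases Nat.eq_zero_or_pos k with rfl | hk
    · simp [hp0]
    · have := hp k
      calc PowerSeries.coeff k p * (r ^ i * s) ^ k
          = (r ^ i) ^ k * (PowerSeries.coeff k p * s ^ k) := by rw [mul_pow]; ring
        _ ≤ r ^ i * (PowerSeries.coeff k p * s ^ k) := by
          gcongr
          exact pow_le_of_le_one (by positivity) (pow_le_one₀ hr0 hr1) hk.ne'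
  have hsum : Summable fun k => r ^ i * (PowerSeries.coeff k p • s ^ k) := by
    simpa using hs.mul_left (r ^ i)
  exact Summable.tsum_le_tsum hle (Summable.of_nonneg_of_le (fun k => by
    have := hp k
    simp only [smul_eq_mul]; positivity) hle hsum) hsum

theorem PowerSeries.hasSum_coeff_subst_X_pow [CompleteSpace 𝕜]
    (hp : ∀ n, 0 ≤ PowerSeries.coeff n p) {w : 𝕜}
    (hw1 : ‖w‖ ≤ 1) (hw : Summable fun n => PowerSeries.coeff n p * ‖w‖ ^ n) (i : ℕ) :
    HasSum (fun n => (PowerSeries.coeff n (p.subst (PowerSeries.X ^ (i + 1) : PowerSeries ℝ)) /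
      (i + 1 : ℕ)) • w ^ n) (((i + 1 : ℕ) : ℝ)⁻¹ • p.evalSum (w ^ (i + 1))) := by
  have hinj : Function.Injective fun k : ℕ => (i + 1) * k :=
    fun a b h => Nat.eq_of_mul_eq_mul_left (Nat.succ_pos i) h
  rw [← hinj.hasSum_iff]
  · have h1 : ‖w ^ (i + 1)‖ ≤ ‖w‖ := by
      rw [norm_pow]; exact pow_le_of_le_one (norm_nonneg _) hw1 i.succ_ne_zero
    have h2 := ((PowerSeries.summable_smul_pow_of_norm_le hp hw h1).hasSum).const_smul
      (((i + 1 : ℕ) : ℝ)⁻¹)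
    convert! h2 using 2 with k
    simp only [Function.comp]
    rw [PowerSeries.coeff_subst_X_pow i.succ_ne_zero, if_pos (Dvd.intro _ rfl),
      Nat.mul_div_cancel_left _ i.succ_pos, smul_smul, ← pow_mul, div_eq_inv_mul]
    simp
  · intro n hn
    rw [PowerSeries.coeff_subst_X_pow i.succ_ne_zero, if_neg, zero_div, zero_smul]
    rintro ⟨k, rfl⟩
    exact hn ⟨k, rfl⟩

end EvalSum

theorem coeff_genSeries (c : ℕ → ℝ) (n : ℕ) :
    PowerSeries.coeff n (genSeries c) = if n = 0 then 0 else c n := by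
  rw [genSeries, PowerSeries.coeff_mk]

theorem genFun_eq_evalSum (c : ℕ → ℝ) (x : ℝ) : genFun c x = (genSeries c).evalSum x := rfl

theorem coeff_subst_genSeries_nonneg {c : ℕ → ℝ}
    (hc : ∀ n, 0 ≤ PowerSeries.coeff n (genSeries c)) {j : ℕ} (hj : j ≠ 0) (n : ℕ) :
    0 ≤ PowerSeries.coeff n ((genSeries c).subst (PowerSeries.X ^ j : PowerSeries ℝ)) := by
  rw [PowerSeries.coeff_subst_X_pow hj]
  split_ifs
  · exact hc _
  · exact le_rfl

theorem coeff_logMultisetSeries_nonneg {c : ℕ → ℝ}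
    (hc : ∀ n, 0 ≤ PowerSeries.coeff n (genSeries c)) (n : ℕ) :
    0 ≤ PowerSeries.coeff n (logMultisetSeries c 1) := by
  rw [logMultisetSeries, PowerSeries.coeff_mk]
  refine Finset.sum_nonneg fun j hj => ?_
  have := coeff_subst_genSeries_nonneg hc (show j ≠ 0 by rw [Finset.mem_Icc] at hj; omega) n
  positivity

theorem constantCoeff_logMultisetSeries (c : ℕ → ℝ) (y : ℝ) :
    PowerSeries.constantCoeff (logMultisetSeries c y) = 0 := by
  rw [← PowerSeries.coeff_zero_eq_constantCoeff_apply, logMultisetSeries, PowerSeries.coeff_mk]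
  simp

/-- No `j = i + 1 > n` divides a positive `n`, so extending the finite sum to all `j` adds only
zeros; for `n = 0` the terms vanish because `C` has no constant term. -/
theorem hasSum_coeff_logMultisetSeries (c : ℕ → ℝ) (n : ℕ) :
    HasSum (fun i : ℕ => PowerSeries.coeff n
      ((genSeries c).subst (PowerSeries.X ^ (i + 1) : PowerSeries ℝ)) / (i + 1 : ℕ))
      (PowerSeries.coeff n (logMultisetSeries c 1)) := by
  rw [logMultisetSeries, PowerSeries.coeff_mk]
  have h1 : ∑ j ∈ Finset.Icc 1 n, PowerSeries.coeff n
      ((genSeries c).subst (PowerSeries.X ^ j : PowerSeries ℝ)) * 1 ^ j / j =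
      ∑ i ∈ Finset.range n, PowerSeries.coeff n
      ((genSeries c).subst (PowerSeries.X ^ (i + 1) : PowerSeries ℝ)) / (i + 1 : ℕ) := by
    rw [show Finset.Icc 1 n = Finset.Ico 1 (n + 1) from rfl, Finset.sum_Ico_eq_sum_range]
    simp [add_comm 1]
  rw [h1]
  refine hasSum_sum_of_ne_finset_zero fun i hi => ?_
  rw [Finset.mem_range, not_lt] at hi
  rw [PowerSeries.coeff_subst_X_pow i.succ_ne_zero]
  split_ifs with h
  · rcases Nat.eq_zero_or_pos n with rfl | hn
    · simp [coeff_genSeries]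
    · exact absurd (Nat.le_of_dvd hn h) (by omega)
  · simp

/-- The sum `∑_{j ≥ 2} C(w ^ j) / j`. -/
noncomputable def logTail (c : ℕ → ℝ) (w : ℂ) : ℂ :=
  ∑' i : ℕ, ((i + 2 : ℕ) : ℝ)⁻¹ • (genSeries c).evalSum (w ^ (i + 2))

section LogSeries

variable {c : ℕ → ℝ}

theorem hasSum_logMultisetSeries (hc : ∀ n, 0 ≤ PowerSeries.coeff n (genSeries c)) {w : ℂ}
    (hw1 : ‖w‖ < 1) (hw : Summable fun n => PowerSeries.coeff n (genSeries c) * ‖w‖ ^ n) :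
    (Summable fun n => PowerSeries.coeff n (logMultisetSeries c 1) * ‖w‖ ^ n) ∧
    HasSum (fun n => PowerSeries.coeff n (logMultisetSeries c 1) • w ^ n)
      ((genSeries c).evalSum w + logTail c w) := by
  set p := genSeries c with hpdef
  have hp0 : PowerSeries.coeff 0 p = 0 := by simp [hpdef, coeff_genSeries]
  have hwr : Summable fun n => PowerSeries.coeff n p * ‖(‖w‖ : ℝ)‖ ^ n := by simpa using hw
  have hnn : ∀ i n : ℕ, 0 ≤ PowerSeries.coeff n
      (p.subst (PowerSeries.X ^ (i + 1) : PowerSeries ℝ)) / (i + 1 : ℕ) := fun i n =>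
    div_nonneg (coeff_subst_genSeries_nonneg hc i.succ_ne_zero n) (by positivity)
  have hreal := PowerSeries.hasSum_coeff_subst_X_pow hc (w := ‖w‖) (by simpa using hw1.le) hwr
  have hcomplex := PowerSeries.hasSum_coeff_subst_X_pow hc (w := w) hw1.le hw
  have hev : ∀ i : ℕ, 0 ≤ p.evalSum (‖w‖ ^ (i + 1)) := fun i =>
    tsum_nonneg fun k => smul_nonneg (hc k) (by positivity)
  -- Without a constant term, `C(‖w‖ ^ (i + 1)) ≤ ‖w‖ ^ i * C(‖w‖)`, which is geometric.
  have hbound : Summable fun i : ℕ => ((i + 1 : ℕ) : ℝ)⁻¹ • p.evalSum (‖w‖ ^ (i + 1)) := by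
    refine Summable.of_nonneg_of_le (fun i => smul_nonneg (by positivity) (hev i)) (fun i => ?_)
      ((summable_geometric_of_lt_one (norm_nonneg w) hw1).mul_right (p.evalSum ‖w‖))
    calc ((i + 1 : ℕ) : ℝ)⁻¹ • p.evalSum (‖w‖ ^ (i + 1)) ≤ 1 * p.evalSum (‖w‖ ^ (i + 1)) := by
          rw [smul_eq_mul]
          refine mul_le_mul_of_nonneg_right (inv_le_one_of_one_le₀ ?_) (hev i)
          exact_mod_cast i.succ_pos
      _ ≤ _ := by
          rw [one_mul, pow_succ]
          exact PowerSeries.evalSum_pow_mul_le hc hp0 (norm_nonneg w) (norm_nonneg w) hw1.le hw i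
  have hsumr : Summable fun x : ℕ × ℕ => (PowerSeries.coeff x.2
      (p.subst (PowerSeries.X ^ (x.1 + 1) : PowerSeries ℝ)) / (x.1 + 1 : ℕ)) • ‖w‖ ^ x.2 := by
    refine (summable_prod_of_nonneg fun x => smul_nonneg (hnn _ _) (by positivity)).2
      ⟨fun i => (hreal i).summable, ?_⟩
    simpa only [(hreal _).tsum_eq] using hbound
  have hsumc : Summable fun x : ℕ × ℕ => (PowerSeries.coeff x.2
      (p.subst (PowerSeries.X ^ (x.1 + 1) : PowerSeries ℝ)) / (x.1 + 1 : ℕ)) • w ^ x.2 :=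
    Summable.of_norm (hsumr.congr fun x => (norm_smul_pow_of_nonneg (hnn _ _) w _).symm)
  constructor
  · exact (HasSum.swap_of_summable hsumr hreal fun n =>
      (hasSum_coeff_logMultisetSeries c n).smul_const (‖w‖ ^ n)).summable
  · have h := HasSum.swap_of_summable hsumc hcomplex fun n =>
      (hasSum_coeff_logMultisetSeries c n).smul_const (w ^ n)
    convert! h using 1
    rw [(hsumc.hasSum.prod_fiberwise hcomplex).summable.tsum_eq_zero_add, logTail]
    simp [p, add_assoc, one_add_one_eq_two]

theorem hasSum_multisetSeries (hc : ∀ n, 0 ≤ PowerSeries.coeff n (genSeries c)) {w : ℂ}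
    (hw1 : ‖w‖ < 1) (hw : Summable fun n => PowerSeries.coeff n (genSeries c) * ‖w‖ ^ n) :
    (Summable fun n => PowerSeries.coeff n (multisetSeries c 1) * ‖w‖ ^ n) ∧
    HasSum (fun n => PowerSeries.coeff n (multisetSeries c 1) • w ^ n)
      (Complex.exp ((genSeries c).evalSum w) * Complex.exp (logTail c w)) := by
  obtain ⟨h1, h2⟩ := hasSum_logMultisetSeries hc hw1 hw
  have h := PowerSeries.summable_and_hasSum_exp_subst (coeff_logMultisetSeries_nonneg hc)
    (constantCoeff_logMultisetSeries c 1) h1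
  rwa [h2.tsum_eq, Complex.exp_add] at h

theorem coeff_multisetSeries_nonneg (hc : ∀ n, 0 ≤ PowerSeries.coeff n (genSeries c)) (n : ℕ) :
    0 ≤ PowerSeries.coeff n (multisetSeries c 1) :=
  (PowerSeries.hasSum_coeff_exp_subst (constantCoeff_logMultisetSeries c 1) n).nonneg fun d =>
    mul_nonneg (by positivity)
      (PowerSeries.coeff_pow_nonneg (coeff_logMultisetSeries_nonneg hc) d n)

variable {ρ : ℝ}

/-- Only convergence of `C` at `ρ ^ 2` is used, so the tail converges uniformly on the closed disc
of radius `ρ`, even if `C` diverges at `ρ`. The field is general so as to serve both real and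
complex arguments. -/
theorem norm_logTail_term_le (hc : ∀ n, 0 ≤ PowerSeries.coeff n (genSeries c)) (hρ0 : 0 ≤ ρ)
    (hρ1 : ρ ≤ 1) (hsum : Summable fun n => PowerSeries.coeff n (genSeries c) * (ρ ^ 2) ^ n)
    {𝕜 : Type*} [NormedField 𝕜] [NormedAlgebra ℝ 𝕜] {w : 𝕜} (hw : ‖w‖ ≤ ρ)
    (i : ℕ) : ‖((i + 2 : ℕ) : ℝ)⁻¹ • (genSeries c).evalSum (w ^ (i + 2))‖ ≤
      ρ ^ i * (genSeries c).evalSum (ρ ^ 2) := by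
  have hp0 : PowerSeries.coeff 0 (genSeries c) = 0 := by simp [coeff_genSeries]
  have hpow : ρ ^ i * ρ ^ 2 ≤ ρ ^ 2 :=
    mul_le_of_le_one_left (by positivity) (pow_le_one₀ hρ0 hρ1)
  have hsum' : Summable fun n => PowerSeries.coeff n (genSeries c) * (ρ ^ i * ρ ^ 2) ^ n := by
    refine Summable.of_nonneg_of_le (fun n => mul_nonneg (hc n) (by positivity)) (fun n => ?_) hsum
    have := hc n
    gcongr
  have h1 : ‖(genSeries c).evalSum (w ^ (i + 2))‖ ≤ (genSeries c).evalSum (ρ ^ i * ρ ^ 2) := by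
    refine PowerSeries.norm_evalSum_le hc hsum' ?_
    rw [norm_pow, ← pow_add]; gcongr
  have h2 := PowerSeries.evalSum_pow_mul_le hc hp0 hρ0 (sq_nonneg ρ) hρ1 hsum i
  rw [norm_smul, Real.norm_of_nonneg (by positivity)]
  calc _ ≤ 1 * ‖(genSeries c).evalSum (w ^ (i + 2))‖ := by
        gcongr
        refine inv_le_one_of_one_le₀ ?_
        exact_mod_cast (Nat.succ_pos _)
    _ ≤ _ := by rw [one_mul]; exact h1.trans h2

theorem continuousOn_logTail (hc : ∀ n, 0 ≤ PowerSeries.coeff n (genSeries c)) (hρ0 : 0 ≤ ρ)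
    (hρ1 : ρ < 1) (hsum : Summable fun n => PowerSeries.coeff n (genSeries c) * (ρ ^ 2) ^ n) :
    ContinuousOn (logTail c) (Metric.closedBall 0 ρ) := by
  refine continuousOn_tsum (fun i => ?_) ((summable_geometric_of_lt_one hρ0 hρ1).mul_right
    ((genSeries c).evalSum (ρ ^ 2))) fun i w hw =>
      norm_logTail_term_le hc hρ0 hρ1.le hsum (by simpa using hw) i
  have hcont : ContinuousOn (fun w : ℂ => w ^ (i + 2)) (Metric.closedBall 0 ρ) := by fun_prop
  have hmaps : Set.MapsTo (fun w : ℂ => w ^ (i + 2)) (Metric.closedBall 0 ρ)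
      (Metric.closedBall 0 (ρ ^ 2)) := fun w hw => by
    have hw' : ‖w‖ ≤ ρ := by simpa using hw
    rw [mem_closedBall_zero_iff, norm_pow]
    calc ‖w‖ ^ (i + 2) ≤ ρ ^ (i + 2) := by gcongr
      _ ≤ ρ ^ 2 := pow_le_pow_of_le_one hρ0 hρ1.le (by omega)
  exact ((PowerSeries.continuousOn_evalSum hc hsum).comp hcont hmaps).const_smul
    (((i + 2 : ℕ) : ℝ)⁻¹)

theorem summable_genFun_pow (hc : ∀ n, 0 ≤ PowerSeries.coeff n (genSeries c)) (hρ0 : 0 ≤ ρ)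
    (hρ1 : ρ < 1) (hsum : Summable fun n => PowerSeries.coeff n (genSeries c) * (ρ ^ 2) ^ n) :
    Summable fun i : ℕ => genFun c (ρ ^ (i + 2)) / ((i + 2 : ℕ) : ℝ) := by
  refine Summable.of_norm_bounded ((summable_geometric_of_lt_one hρ0 hρ1).mul_right
    ((genSeries c).evalSum (ρ ^ 2))) fun i => ?_
  have := norm_logTail_term_le hc hρ0 hρ1.le hsum (w := ρ) (by simp [abs_of_nonneg hρ0]) i
  rwa [smul_eq_mul, ← div_eq_inv_mul] at this

theorem exp_logTail_ofReal : Complex.exp (logTail c ρ) = (multisetTail c ρ 1 : ℝ) := by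
  rw [multisetTail, Complex.ofReal_exp, logTail, Complex.ofReal_tsum]
  congr 1
  refine tsum_congr fun i => ?_
  rw [← Complex.ofReal_pow, PowerSeries.evalSum_ofReal, Complex.real_smul, one_pow, mul_one,
    div_eq_inv_mul, genFun_eq_evalSum]
  push_cast
  rfl

end LogSeries

/-! ### Power moments as functions of the radius, and the change of scale. -/

/-- The weighted sum `∑ k ^ m * b k * y ^ k`. -/
noncomputable def powerMoment (b : ℕ → ℝ) (m : ℕ) (y : ℝ) : ℝ :=
  ∑' k : ℕ, (k : ℝ) ^ m * b k * y ^ k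

section PowerMoment

variable {b : ℕ → ℝ} {ρ : ℝ}

/-- The operator `y * d/dy` multiplies the `k`-th term by `k`; termwise differentiation is justified
on `(0, r)` for some `z < r < ρ`. -/
theorem hasDerivAt_powerMoment
    (hsum : ∀ m : ℕ, ∀ r ∈ Set.Ioo 0 ρ, Summable fun k : ℕ => (k : ℝ) ^ m * b k * r ^ k)
    (m : ℕ) {z : ℝ} (hz : z ∈ Set.Ioo 0 ρ) :
    HasDerivAt (powerMoment b m) (powerMoment b (m + 1) z / z) z := by
  obtain ⟨r, hzr, hrρ⟩ := exists_between hz.2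
  have hr0 : 0 < r := hz.1.trans hzr
  have hterm : ∀ (y : ℝ) (k : ℕ), y ≠ 0 → (k : ℝ) ^ m * b k * (k * y ^ (k - 1)) =
      (k : ℝ) ^ (m + 1) * b k * y ^ k / y := by
    intro y k hy
    rcases Nat.eq_zero_or_pos k with rfl | hk
    · simp
    · rw [eq_div_iff hy, pow_succ (k : ℝ), mul_assoc, mul_assoc, mul_assoc,
        pow_sub_one_mul (Nat.pos_iff_ne_zero.1 hk)]
      ring
  have hu : Summable fun k : ℕ => ‖(k : ℝ) ^ m * b k * (k * r ^ (k - 1))‖ := by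
    simp only [hterm r _ hr0.ne']
    exact ((hsum (m + 1) r ⟨hr0, hrρ⟩).div_const r).norm
  have h := hasDerivAt_tsum_of_isPreconnected (t := Set.Ioo 0 r)
    (g := fun (k : ℕ) (y : ℝ) => (k : ℝ) ^ m * b k * y ^ k)
    (g' := fun (k : ℕ) (y : ℝ) => (k : ℝ) ^ m * b k * (k * y ^ (k - 1))) hu isOpen_Ioo
    isPreconnected_Ioo (fun k y _ => (hasDerivAt_pow k y).const_mul _)
    (fun k y hy => by
      have hyr : ‖y‖ ≤ ‖r‖ := by
        rw [Real.norm_of_nonneg hy.1.le, Real.norm_of_nonneg hr0.le]; exact hy.2.le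
      simp only [norm_mul, norm_pow y, norm_pow r]
      gcongr) (⟨hz.1, hzr⟩ : z ∈ Set.Ioo 0 r) (hsum m z hz) ⟨hz.1, hzr⟩
  convert! h using 1
  rw [powerMoment, ← tsum_div_const]
  exact tsum_congr fun k => (hterm z k hz.1.ne').symm

theorem powerMoment_strictMonoOn (hb : ∀ k, 0 ≤ b k)
    (hsum : ∀ m : ℕ, ∀ r ∈ Set.Ioo 0 ρ, Summable fun k : ℕ => (k : ℝ) ^ m * b k * r ^ k)
    (hpos : ∃ k : ℕ, 1 ≤ k ∧ 0 < b k) (m : ℕ) : StrictMonoOn (powerMoment b m) (Set.Ioo 0 ρ) := by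
  intro y hy z hz hyz
  obtain ⟨k, hk, hbk⟩ := hpos
  refine Summable.tsum_lt_tsum (i := k) (fun j => ?_) ?_ (hsum m y hy) (hsum m z hz)
  · have := hb j
    have := hy.1.le
    gcongr
  · have := hy.1.le
    have hk0 : (0 : ℝ) < k := by exact_mod_cast hk
    have : y ^ k < z ^ k := pow_lt_pow_left₀ hyz this (by omega)
    gcongr

theorem powerMoment_le_mul (hb : ∀ k, 0 ≤ b k) (hb0 : b 0 = 0)
    (hsum : ∀ m : ℕ, ∀ r ∈ Set.Ioo 0 ρ, Summable fun k : ℕ => (k : ℝ) ^ m * b k * r ^ k)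
    (m : ℕ) {r t : ℝ} (hr : r ∈ Set.Ioo 0 ρ) (ht : t ∈ Set.Ioc 0 1) :
    powerMoment b m (t * r) ≤ t * powerMoment b m r := by
  have htr : t * r ∈ Set.Ioo 0 ρ :=
    ⟨mul_pos ht.1 hr.1, (mul_le_of_le_one_left hr.1.le ht.2).trans_lt hr.2⟩
  rw [powerMoment, powerMoment, ← tsum_mul_left]
  refine Summable.tsum_le_tsum (fun k => ?_) (hsum m _ htr) ((hsum m r hr).mul_left t)
  rcases Nat.eq_zero_or_pos k with rfl | hk
  · simp [hb0]
  · have := hb k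
    have := hr.1.le
    have h1 : t ^ k ≤ t := pow_le_of_le_one ht.1.le ht.2 hk.ne'
    calc (k : ℝ) ^ m * b k * (t * r) ^ k = t ^ k * ((k : ℝ) ^ m * b k * r ^ k) := by
          rw [mul_pow]; ring
      _ ≤ _ := by gcongr

end PowerMoment

/-- The scale `x` with `ρ e^{-1/x} = z`. -/
noncomputable def invLogRatio (ρ z : ℝ) : ℝ := 1 / Real.log (ρ / z)

theorem invLogRatio_pos {ρ z : ℝ} (hz : z ∈ Set.Ioo 0 ρ) : 0 < invLogRatio ρ z :=
  one_div_pos.2 (Real.log_pos ((one_lt_div hz.1).2 hz.2))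

theorem mul_exp_invLogRatio {ρ z : ℝ} (hz : z ∈ Set.Ioo 0 ρ) :
    ρ * Real.exp (-1 / invLogRatio ρ z) = z := by
  have hρ : 0 < ρ := hz.1.trans hz.2
  have hz0 := hz.1
  rw [invLogRatio, neg_div, one_div_one_div, Real.exp_neg, Real.exp_log (by positivity), inv_div]
  field_simp

theorem tendsto_invLogRatio {ρ : ℝ} (hρ : 0 < ρ) {z : ℕ → ℝ}
    (hz : ∀ᶠ n in atTop, z n ∈ Set.Ioo 0 ρ) (hlim : Tendsto z atTop (𝓝 ρ)) :
    Tendsto (fun n => invLogRatio ρ (z n)) atTop atTop := by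
  have h1 : Tendsto (fun n => Real.log (ρ / z n)) atTop (𝓝 0) := by
    have := (Real.continuousAt_log one_ne_zero).tendsto.comp
      (show Tendsto (fun n => ρ / z n) atTop (𝓝 1) by
        have := (tendsto_const_nhds (x := ρ) (f := atTop)).div hlim hρ.ne'
        rwa [div_self hρ.ne'] at this)
    simpa [Function.comp_def] using this
  have h2 : Tendsto (fun n => Real.log (ρ / z n)) atTop (𝓝[>] 0) := by
    refine tendsto_nhdsWithin_iff.2 ⟨h1, ?_⟩
    filter_upwards [hz] with n hn
    exact Real.log_pos ((one_lt_div hn.1).2 hn.2)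
  simpa [invLogRatio, Function.comp_def] using tendsto_inv_nhdsGT_zero.comp h2

/-! ### Expansive sequences: the saddle point and the final asymptotics. -/

section Expansive

variable {c : ℕ → ℝ} {α ρ : ℝ}

/-- The coefficients of an expansive sequence, normalised by `ρ ^ k`. -/
noncomputable def scaledCoeff (c : ℕ → ℝ) (ρ : ℝ) (k : ℕ) : ℝ :=
  PowerSeries.coeff k (genSeries c) * ρ ^ k

theorem IsExpansive.exists_hasPowerScale (hc : IsExpansive c α ρ) :
    ∃ H : ℝ → ℝ, HasPowerScale (scaledCoeff c ρ) H := by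
  obtain ⟨h, hh, hch⟩ := hc.exists_slowlyVarying
  refine ⟨_, hh.hasPowerScale hc.alpha_pos (by simp [scaledCoeff, coeff_genSeries])
    fun k hk => ?_⟩
  have := hc.rho_pos
  rw [scaledCoeff, coeff_genSeries, if_neg (by omega), hch k hk, zpow_neg, zpow_natCast]
  field_simp

theorem scaledCoeff_mul_exp (c : ℕ → ℝ) (ρ x : ℝ) (k : ℕ) :
    scaledCoeff c ρ k * Real.exp (-k / x) =
      PowerSeries.coeff k (genSeries c) * (ρ * Real.exp (-1 / x)) ^ k := by
  rw [scaledCoeff, mul_pow, ← Real.exp_nat_mul]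
  ring_nf

theorem expMoment_scaledCoeff (c : ℕ → ℝ) (ρ x : ℝ) (m : ℕ) :
    expMoment (scaledCoeff c ρ) m x =
      powerMoment (fun k => PowerSeries.coeff k (genSeries c)) m (ρ * Real.exp (-1 / x)) :=
  tsum_congr fun k => by rw [mul_assoc, scaledCoeff_mul_exp, mul_assoc]

theorem expCharFun_scaledCoeff (c : ℕ → ℝ) (ρ x θ : ℝ) :
    expCharFun (scaledCoeff c ρ) x θ = (genSeries c).evalSum
      (((ρ * Real.exp (-1 / x) : ℝ) : ℂ) * Complex.exp (θ * Complex.I)) := by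
  refine tsum_congr fun k => ?_
  rw [scaledCoeff_mul_exp, Complex.real_smul, mul_pow _ (Complex.exp _),
    ← Complex.exp_nat_mul]
  push_cast
  ring_nf

theorem genFun_eq_powerMoment (c : ℕ → ℝ) :
    genFun c = powerMoment (fun k => PowerSeries.coeff k (genSeries c)) 0 := by
  ext x
  simp [genFun, powerMoment]

theorem IsExpansive.coeff_genSeries_nonneg (hc : IsExpansive c α ρ) (k : ℕ) :
    0 ≤ PowerSeries.coeff k (genSeries c) := by
  obtain ⟨H, hH⟩ := hc.exists_hasPowerScale
  exact nonneg_of_mul_nonneg_left (hH.nonneg k) (pow_pos hc.rho_pos k)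

theorem IsExpansive.exists_coeff_pos (hc : IsExpansive c α ρ) :
    ∃ k : ℕ, 1 ≤ k ∧ 0 < PowerSeries.coeff k (genSeries c) := by
  obtain ⟨H, hH⟩ := hc.exists_hasPowerScale
  by_contra! hcon
  obtain ⟨x, hx⟩ := ((hH.tendsto_expMoment 0).eventually_gt_atTop 0).exists
  refine hx.ne' ((tsum_congr fun k => ?_).trans tsum_zero)
  have : PowerSeries.coeff k (genSeries c) = 0 := by
    rcases Nat.eq_zero_or_pos k with rfl | hk
    · simp [coeff_genSeries]
    · exact le_antisymm (hcon k hk) (hc.coeff_genSeries_nonneg k)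
  simp [scaledCoeff, this]

theorem IsExpansive.summable_powerMoment (hc : IsExpansive c α ρ) (m : ℕ) :
    ∀ r ∈ Set.Ioo 0 ρ, Summable fun k : ℕ =>
      (k : ℝ) ^ m * PowerSeries.coeff k (genSeries c) * r ^ k := by
  intro r hr
  obtain ⟨H, hH⟩ := hc.exists_hasPowerScale
  refine (hH.summable m (invLogRatio_pos hr)).congr fun k => ?_
  rw [mul_assoc, scaledCoeff_mul_exp, mul_exp_invLogRatio hr, mul_assoc]

theorem IsExpansive.summable_coeff (hc : IsExpansive c α ρ) {r : ℝ} (hr : r ∈ Set.Ioo 0 ρ) :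
    Summable fun k : ℕ => PowerSeries.coeff k (genSeries c) * r ^ k := by
  simpa using hc.summable_powerMoment 0 r hr

theorem IsExpansive.mul_deriv_genFun (hc : IsExpansive c α ρ) {z : ℝ} (hz : z ∈ Set.Ioo 0 ρ) :
    z * deriv (genFun c) z = powerMoment (fun k => PowerSeries.coeff k (genSeries c)) 1 z := by
  rw [genFun_eq_powerMoment, (hasDerivAt_powerMoment hc.summable_powerMoment 0 hz).deriv,
    mul_div_cancel₀ _ hz.1.ne']

theorem IsExpansive.sq_mul_deriv_deriv_genFun (hc : IsExpansive c α ρ) {z : ℝ}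
    (hz : z ∈ Set.Ioo 0 ρ) :
    z ^ 2 * deriv (deriv (genFun c)) z =
      powerMoment (fun k => PowerSeries.coeff k (genSeries c)) 2 z -
        powerMoment (fun k => PowerSeries.coeff k (genSeries c)) 1 z := by
  have heq : deriv (genFun c) =ᶠ[𝓝 z]
      fun y => powerMoment (fun k => PowerSeries.coeff k (genSeries c)) 1 y / y := by
    filter_upwards [isOpen_Ioo.mem_nhds hz] with y hy
    rw [← hc.mul_deriv_genFun hy, mul_div_cancel_left₀ _ hy.1.ne']
  rw [heq.deriv_eq, ((hasDerivAt_powerMoment hc.summable_powerMoment 1 hz).fun_div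
    (hasDerivAt_id' z) hz.1.ne').deriv]
  have := hz.1.ne'
  field_simp

theorem IsExpansive.existsUnique_saddle (hc : IsExpansive c α ρ) {n : ℕ} (hn : 1 ≤ n) :
    ∃! z : ℝ, z ∈ Set.Ioo 0 ρ ∧ z * deriv (genFun c) z = n := by
  set M := powerMoment (fun k => PowerSeries.coeff k (genSeries c)) 1 with hM
  have hmono : StrictMonoOn M (Set.Ioo 0 ρ) :=
    powerMoment_strictMonoOn hc.coeff_genSeries_nonneg hc.summable_powerMoment hc.exists_coeff_pos 1
  have hcont : ContinuousOn M (Set.Ioo 0 ρ) := fun z hz =>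
    (hasDerivAt_powerMoment hc.summable_powerMoment 1 hz).continuousAt.continuousWithinAt
  obtain ⟨H, hH⟩ := hc.exists_hasPowerScale
  obtain ⟨x, hx, hx0⟩ := (((hH.tendsto_expMoment 1).eventually_ge_atTop (n : ℝ)).and
    (eventually_gt_atTop 0)).exists
  rw [expMoment_scaledCoeff, ← hM] at hx
  set r := ρ * Real.exp (-1 / x)
  have hr : r ∈ Set.Ioo 0 ρ := by
    refine ⟨mul_pos hc.rho_pos (Real.exp_pos _), mul_lt_of_lt_one_right hc.rho_pos ?_⟩
    rw [Real.exp_lt_one_iff, neg_div]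
    exact neg_neg_of_pos (by positivity)
  have hMr : 0 ≤ M r := (Nat.cast_nonneg n).trans hx
  -- Shrinking `r` by this factor brings the moment down to at most `M r / (M r + 1) ≤ 1 ≤ n`, the
  -- lower end for the intermediate value theorem.
  have ht : 1 / (M r + 1) ∈ Set.Ioc (0 : ℝ) 1 :=
    ⟨by positivity, by rw [div_le_one (by positivity)]; linarith⟩
  have hsmall : M (1 / (M r + 1) * r) ≤ n := by
    calc M (1 / (M r + 1) * r) ≤ 1 / (M r + 1) * M r :=
          powerMoment_le_mul hc.coeff_genSeries_nonneg (by simp [coeff_genSeries])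
            hc.summable_powerMoment 1 hr ht
      _ ≤ 1 := by rw [one_div_mul_eq_div, div_le_one (by positivity)]; linarith
      _ ≤ n := by exact_mod_cast hn
  have hle : 1 / (M r + 1) * r ≤ r := mul_le_of_le_one_left hr.1.le ht.2
  have hsub : Set.Icc (1 / (M r + 1) * r) r ⊆ Set.Ioo 0 ρ := fun y hy =>
    ⟨(mul_pos ht.1 hr.1).trans_le hy.1, hy.2.trans_lt hr.2⟩
  obtain ⟨z, hz, hzn⟩ := intermediate_value_Icc hle (hcont.mono hsub) ⟨hsmall, hx⟩
  refine ⟨z, ⟨hsub hz, (hc.mul_deriv_genFun (hsub hz)).trans hzn⟩, ?_⟩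
  rintro y ⟨hy, hyn⟩
  rw [hc.mul_deriv_genFun hy] at hyn
  exact hmono.injOn hy (hsub hz) (hyn.trans hzn.symm)

theorem IsExpansive.tendsto_saddle (hc : IsExpansive c α ρ) {z : ℕ → ℝ}
    (hz : ∀ n : ℕ, 1 ≤ n → z n ∈ Set.Ioo 0 ρ ∧ z n * deriv (genFun c) (z n) = n) :
    Tendsto z atTop (𝓝 ρ) := by
  have hmono := powerMoment_strictMonoOn hc.coeff_genSeries_nonneg hc.summable_powerMoment
    hc.exists_coeff_pos 1
  refine tendsto_order.2 ⟨fun r hr => ?_, fun r hr => ?_⟩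
  -- The maximum guards against `r ≤ 0`, where monotonicity is not available.
  · have hr' : max r (ρ / 2) ∈ Set.Ioo 0 ρ := by
      have := hc.rho_pos
      exact ⟨lt_max_of_lt_right (by linarith), max_lt hr (by linarith)⟩
    filter_upwards [eventually_ge_atTop 1, tendsto_natCast_atTop_atTop.eventually_gt_atTop
      (powerMoment (fun k => PowerSeries.coeff k (genSeries c)) 1 (max r (ρ / 2)))] with n hn hlt
    obtain ⟨h1, h2⟩ := hz n hn
    rw [← h2, hc.mul_deriv_genFun h1, hmono.lt_iff_lt hr' h1] at hlt
    exact (le_max_left _ _).trans_lt hlt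
  · filter_upwards [eventually_ge_atTop 1] with n hn
    exact (hz n hn).1.2.trans hr

/-- Cauchy's formula on the circle of radius `z`: the saddle equation makes the first moment equal
to `n`, so the linear phase in the integrand is exactly the kernel `exp (-i n θ)`. -/
theorem IsExpansive.integral_eq (hc : IsExpansive c α ρ) {z : ℝ} (hz : z ∈ Set.Ioo 0 ρ) {n : ℕ}
    (hn : z * deriv (genFun c) z = n) :
    ∫ θ in (-Real.pi)..Real.pi,
      Complex.exp (expCharFun (scaledCoeff c ρ) (invLogRatio ρ z) θ -
        expMoment (scaledCoeff c ρ) 0 (invLogRatio ρ z) -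
        Complex.I * (expMoment (scaledCoeff c ρ) 1 (invLogRatio ρ z) * θ : ℝ)) *
        Complex.exp (logTail c ((ρ * Real.exp (-1 / invLogRatio ρ z) : ℝ) *
          Complex.exp (θ * Complex.I))) =
      ((2 * Real.pi * (PowerSeries.coeff n (multisetSeries c 1) * z ^ n) *
        Real.exp (-genFun c z) : ℝ) : ℂ) := by
  have hnorm : ∀ θ : ℝ, ‖(z : ℂ) * Complex.exp (θ * Complex.I)‖ = z := by
    intro θ
    rw [norm_mul, Complex.norm_exp_ofReal_mul_I, mul_one, Complex.norm_real,
      Real.norm_of_nonneg hz.1.le]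
  have hmul : ∀ θ : ℝ, _ := fun θ => hasSum_multisetSeries hc.coeff_genSeries_nonneg
    (w := (z : ℂ) * Complex.exp (θ * Complex.I)) (by rw [hnorm]; exact hz.2.trans hc.rho_lt_one)
    (by rw [hnorm]; exact hc.summable_coeff hz)
  have hsum := (hmul 0).1
  rw [hnorm] at hsum
  have h := integral_eq_coeff_of_summable
    (coeff_multisetSeries_nonneg hc.coeff_genSeries_nonneg) hz.1 hsum (fun θ => (hmul θ).2) n
  have hS1 : powerMoment (fun k => PowerSeries.coeff k (genSeries c)) 1 z = n := by
    rw [← hc.mul_deriv_genFun hz, hn]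
  have hR : ((2 * Real.pi * (PowerSeries.coeff n (multisetSeries c 1) * z ^ n) *
        Real.exp (-genFun c z) : ℝ) : ℂ) = (∫ θ in (-Real.pi)..Real.pi,
      Complex.exp ((genSeries c).evalSum ((z : ℂ) * Complex.exp (θ * Complex.I))) *
        Complex.exp (logTail c ((z : ℂ) * Complex.exp (θ * Complex.I))) *
        Complex.exp (-(n * θ * Complex.I))) * Complex.exp (-genFun c z) := by
    rw [h]; push_cast; ring
  rw [hR, ← intervalIntegral.integral_mul_const]
  refine intervalIntegral.integral_congr fun θ _ => ?_
  simp only [expCharFun_scaledCoeff, expMoment_scaledCoeff, mul_exp_invLogRatio hz, hS1,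
    ← genFun_eq_powerMoment]
  rw [sub_sub, sub_eq_add_neg, neg_add, Complex.exp_add, Complex.exp_add,
    show -(Complex.I * ((n * θ : ℝ) : ℂ)) = -(n * θ * Complex.I) by push_cast; ring]
  ring

theorem IsExpansive.tendsto_coeff (hc : IsExpansive c α ρ) {z : ℕ → ℝ}
    (hz : ∀ n : ℕ, 1 ≤ n → z n ∈ Set.Ioo 0 ρ ∧ z n * deriv (genFun c) (z n) = n) :
    Tendsto (fun n => Real.sqrt (2 * Real.pi *
        powerMoment (fun k => PowerSeries.coeff k (genSeries c)) 2 (z n)) *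
      (PowerSeries.coeff n (multisetSeries c 1) * z n ^ n * Real.exp (-genFun c (z n))))
      atTop (𝓝 (multisetTail c ρ 1)) := by
  obtain ⟨H, hH⟩ := hc.exists_hasPowerScale
  have hzmem : ∀ᶠ n in atTop, z n ∈ Set.Ioo 0 ρ := by
    filter_upwards [eventually_ge_atTop 1] with n hn using (hz n hn).1
  have hρ2 : ρ ^ 2 ∈ Set.Ioo 0 ρ :=
    ⟨pow_pos hc.rho_pos 2, by nlinarith [hc.rho_pos, hc.rho_lt_one]⟩
  have hφ : ContinuousOn (fun w => Complex.exp (logTail c w)) (Metric.closedBall 0 ρ) :=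
    Complex.continuous_exp.comp_continuousOn (continuousOn_logTail hc.coeff_genSeries_nonneg
      hc.rho_pos.le hc.rho_lt_one (hc.summable_coeff hρ2))
  have h := (hH.tendsto_integral hc.rho_pos hφ).comp
    (tendsto_invLogRatio hc.rho_pos hzmem (hc.tendsto_saddle hz))
  rw [exp_logTail_ofReal, ← Complex.ofReal_mul] at h
  -- Dividing Cauchy's `2π` by the Gaussian constant `√(2π)` leaves the `√(2π)` of the statement.
  have h2 := ((Complex.continuous_re.tendsto _).comp h).const_mul (Real.sqrt (2 * Real.pi))⁻¹
  rw [Complex.ofReal_re, inv_mul_cancel_left₀ (by positivity)] at h2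
  refine h2.congr' ?_
  filter_upwards [eventually_ge_atTop 1] with n hn
  obtain ⟨hzn, hzn'⟩ := hz n hn
  simp only [Function.comp]
  rw [hc.integral_eq hzn hzn', ← Complex.ofReal_mul, Complex.ofReal_re, expMoment_scaledCoeff,
    mul_exp_invLogRatio hzn, Real.sqrt_mul (show 0 ≤ 2 * Real.pi by positivity)]
  have hs : Real.sqrt (2 * Real.pi) ^ 2 = 2 * Real.pi := Real.sq_sqrt (by positivity)
  have hs0 : Real.sqrt (2 * Real.pi) ≠ 0 := by positivity
  generalize Real.sqrt (2 * Real.pi) = q at *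
  rw [← hs]
  field_simp

end Expansive

theorem IsExpansive.isEquivalent_coeff {c : ℕ → ℝ} {α ρ : ℝ} (hc : IsExpansive c α ρ) {z : ℕ → ℝ}
    (hz : ∀ n : ℕ, 1 ≤ n → z n ∈ Set.Ioo 0 ρ ∧ z n * deriv (genFun c) (z n) = n) :
    (fun n : ℕ => PowerSeries.coeff n (multisetSeries c 1)) ~[atTop]
      (fun n : ℕ => multisetTail c ρ 1 *
        (Real.exp (genFun c (z n)) /
          Real.sqrt (2 * Real.pi * z n ^ 2 * deriv (deriv (genFun c)) (z n))) *
        z n ^ (-(n : ℤ))) := by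
  set M := powerMoment (fun k => PowerSeries.coeff k (genSeries c)) with hM
  have hT : 0 < multisetTail c ρ 1 := Real.exp_pos _
  obtain ⟨H, hH⟩ := hc.exists_hasPowerScale
  have hzmem : ∀ᶠ n in atTop, z n ∈ Set.Ioo 0 ρ := by
    filter_upwards [eventually_ge_atTop 1] with n hn using (hz n hn).1
  have hx := tendsto_invLogRatio hc.rho_pos hzmem (hc.tendsto_saddle hz)
  have hmom : ∀ m : ℕ, (fun n => expMoment (scaledCoeff c ρ) m (invLogRatio ρ (z n))) =ᶠ[atTop]
      fun n => M m (z n) := fun m => by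
    filter_upwards [hzmem] with n hn
    rw [expMoment_scaledCoeff, mul_exp_invLogRatio hn]
  have h2 : Tendsto (fun n => M 2 (z n)) atTop atTop :=
    ((hH.tendsto_expMoment 2).comp hx).congr' (hmom 2)
  have h12 : Tendsto (fun n => M 1 (z n) / M 2 (z n)) atTop (𝓝 0) :=
    (hH.tendsto_expMoment_one_div_two.comp hx).congr' ((hmom 1).div (hmom 2))
  -- Correction factor for passing from the second moment to `z ^ 2 * C''(z) = M 2 z - M 1 z`.
  have hratio : Tendsto (fun n => Real.sqrt (1 - M 1 (z n) / M 2 (z n))) atTop (𝓝 1) := by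
    have := (Real.continuous_sqrt.tendsto _).comp (h12.const_sub 1)
    simpa [Function.comp_def] using this
  have hmain := ((hc.tendsto_coeff hz).mul hratio).div_const (multisetTail c ρ 1)
  rw [mul_one, div_self hT.ne', ← hM] at hmain
  refine isEquivalent_of_tendsto_one (hmain.congr' ?_)
  filter_upwards [hzmem, h2.eventually_gt_atTop 0, h12.eventually_lt_const one_pos]
    with n hn hpos hlt
  have hC : 2 * Real.pi * z n ^ 2 * deriv (deriv (genFun c)) (z n) =
      2 * Real.pi * M 2 (z n) * (1 - M 1 (z n) / M 2 (z n)) := by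
    rw [mul_assoc _ (z n ^ 2), hc.sq_mul_deriv_deriv_genFun hn, ← hM]
    field_simp
  have hz0 : 0 < z n := hn.1
  have hlt' : 0 < 1 - M 1 (z n) / M 2 (z n) := by linarith
  have hs1 : Real.sqrt (2 * Real.pi * M 2 (z n)) ≠ 0 := by positivity
  have hs2 : Real.sqrt (1 - M 1 (z n) / M 2 (z n)) ≠ 0 := by positivity
  simp only [Pi.div_apply]
  rw [hC, Real.sqrt_mul (show 0 ≤ 2 * Real.pi * M 2 (z n) by positivity), zpow_neg, zpow_natCast, Real.exp_neg]
  generalize Real.sqrt (2 * Real.pi * M 2 (z n)) = s₁ at *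
  generalize Real.sqrt (1 - M 1 (z n) / M 2 (z n)) = s₂ at *
  field_simp

theorem mainTheorem3 (c : ℕ → ℝ) (α ρ : ℝ) (hc : IsExpansive c α ρ) :
    (∀ n : ℕ, 1 ≤ n → ∃! z : ℝ, z ∈ Set.Ioo 0 ρ ∧ z * deriv (genFun c) z = n) ∧
    Summable (fun i : ℕ => genFun c (ρ ^ (i + 2)) / ((i + 2 : ℕ) : ℝ)) ∧
    ∀ z : ℕ → ℝ,
      (∀ n : ℕ, 1 ≤ n → z n ∈ Set.Ioo 0 ρ ∧ z n * deriv (genFun c) (z n) = n) →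
      Tendsto z atTop (𝓝 ρ) ∧
      (fun n : ℕ => PowerSeries.coeff n (multisetSeries c 1)) ~[atTop]
        (fun n : ℕ => multisetTail c ρ 1 *
          (Real.exp (genFun c (z n)) /
            Real.sqrt (2 * Real.pi * z n ^ 2 * deriv (deriv (genFun c)) (z n))) *
          z n ^ (-(n : ℤ))) := by
  refine ⟨fun n hn => hc.existsUnique_saddle hn, ?_,
    fun z hz => ⟨hc.tendsto_saddle hz, hc.isEquivalent_coeff hz⟩⟩
  have hρ2 : ρ ^ 2 ∈ Set.Ioo 0 ρ :=
    ⟨pow_pos hc.rho_pos 2, by nlinarith [hc.rho_pos, hc.rho_lt_one]⟩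
  exact summable_genFun_pow hc.coeff_genSeries_nonneg hc.rho_pos.le hc.rho_lt_one
    (hc.summable_coeff hρ2)
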